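/- Let $k$ be a field, let $q\in k^\times$ not be a root of unity, and let $R$ be a (left and right) noetherian $k$-algebra. Let $S=R[x;\tau,\delta]$ be an Ore extension, where $\tau$ is a $k$-algebra automorphism of $R$ and $\delta$ is a $k$-linear $\tau$-derivation; thus $S$ is a free left $R$-module on the powers of $x$ and $xr=\tau(r)x+\delta(r)$ for $r\in R$. For a group $H$ acting on an algebra $A$ by $k$-algebra automorphisms, an $H$-prime ideal of $A$ is a proper $H$-stable (two-sided) ideal $P$ such that $IJ\subseteq P$ implies $I\subseteq P$ or $J\subseteq P$ for all $H$-stable ideals $I,J$ of $A$; $\operatorname{Spec}_H A$ denotes the set of these ideals, ordered by inclusion. Assume that $S$ is a Cauchon extension of $R$, that is: (i) $\delta$ is locally nilpotent; (ii) $\delta\tau=q\tau\delta$; (iii) an abelian group $H$ acts on $S$ by $k$-algebra automorphisms; (iv) $R$ is $H$-stable and $x$ is an $H$-eigenvector; (v) there is $h_0\in H$ with $h_0|_R=\tau$ such that the $h_0$-eigenvalue of $x$ is not a root of unity; (vi) every $H$-prime ideal of $R$ is completely prime. Let $L=S[x^{-1}]$ be the localization of $S$ at the powers of $x$, and let $C:R\to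 L$ be Cauchon's deleting-derivation map $$C(r)=\sum_{l=0}^{\infty}q_l\,\delta^l\tau^{-l}(r)\,x^{-l},\qquad q_l=q^{l(l+1)/2}\,\frac{(q-1)^{-l}}{(l)!_q},\qquad (l)!_q=\prod_{i=1}^{l}(1+q+\cdots+q^{i-1}),$$ in which only finitely many terms are nonzero. For a subset $X$ of $L$, let $\langle X\rangle_L$ denote the two-sided ideal of $L$ generated by $X$. Then $$P\longmapsto\langle C(P)\rangle_L\cap S$$ is an isomorphism of partially ordered sets from $\operatorname{Spec}_H R$ onto $\{Q\in\operatorname{Spec}_H S: x\notin Q\}$. -/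

import Mathlib

/-- `S = R[x; τ, δ]` is the Ore extension (skew polynomial algebra) of the `k`-algebra `R` by the
algebra automorphism `τ` and the `τ`-derivation `δ`: `S` contains `R` (through `ι`), it is a free
left `R`-module on the powers of `x`, and `x r = τ(r) x + δ(r)` for all `r` in `R`. -/
structure IsOreExtension {k R S : Type*} [Field k] [Ring R] [Algebra k R] [Ring S] [Algebra k S]
    (ι : R →ₐ[k] S) (x : S) (τ : R ≃ₐ[k] R) (δ : R →ₗ[k] R) : Prop where
  /-- `δ` is a (left) `τ`-derivation. -/
  leibniz : ∀ a b : R, δ (a * b) = τ a * δ b + δ a * b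
  /-- Every element of `S` is `∑ rᵢ xⁱ` for a unique finitely supported family `(rᵢ)` in `R`. -/
  bijective : Function.Bijective fun p : ℕ →₀ R => p.sum fun i r => ι r * x ^ i
  /-- The commutation rule. -/
  comm : ∀ r : R, x * ι r = ι (τ r) * x + ι (δ r)

/-- `δ` is locally nilpotent. -/
def IsLocNilpotent {k R : Type*} [Field k] [Ring R] [Algebra k R] (δ : R →ₗ[k] R) : Prop :=
  ∀ r : R, ∃ n : ℕ, (δ ^ n) r = 0

section HSpec

variable {k A H : Type*} [Field k] [Ring A] [Algebra k A] [Group H]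

/-- An ideal is `H`-stable for an action of `H` by algebra automorphisms. -/
def IsHStable (ρ : H →* (A ≃ₐ[k] A)) (I : TwoSidedIdeal A) : Prop :=
  ∀ (h : H) (a : A), a ∈ I → ρ h a ∈ I

/-- An `H`-prime ideal: a proper `H`-stable ideal `P` such that, for `H`-stable ideals `I` and `J`,
`I J ⊆ P` implies `I ⊆ P` or `J ⊆ P`. -/
structure IsHPrime (ρ : H →* (A ≃ₐ[k] A)) (P : TwoSidedIdeal A) : Prop where
  ne_top : P ≠ ⊤
  stable : IsHStable ρ P
  prime : ∀ I J : TwoSidedIdeal A, IsHStable ρ I → IsHStable ρ J →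
    (∀ a ∈ I, ∀ b ∈ J, a * b ∈ P) → I ≤ P ∨ J ≤ P

/-- The `H`-prime spectrum, ordered by inclusion. -/
abbrev HSpec (ρ : H →* (A ≃ₐ[k] A)) : Type _ := {P : TwoSidedIdeal A // IsHPrime ρ P}

end HSpec

/-- A completely prime ideal: a proper ideal `P` with `A / P` a domain. -/
def IsCompletelyPrime {A : Type*} [Ring A] (P : TwoSidedIdeal A) : Prop :=
  P ≠ ⊤ ∧ ∀ a b : A, a * b ∈ P → a ∈ P ∨ b ∈ P

/-- `a` is not a root of unity. -/
def NotRootOfUnity {k : Type*} [Field k] (a : k) : Prop :=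
  ∀ n : ℕ, 0 < n → a ^ n ≠ 1

/-- `S = R[x; τ, δ]` is a Cauchon extension of the noetherian algebra `R` with respect to the
abelian group `H`, acting on `S` by `ρS`; that `R` is `H`-stable is recorded by the action `ρR` on
`R` of which `ρS` is an extension. -/
structure IsCauchonExtension {k R S H : Type*} [Field k] [Ring R] [Algebra k R] [Ring S]
    [Algebra k S] [CommGroup H] (ι : R →ₐ[k] S) (x : S) (τ : R ≃ₐ[k] R) (δ : R →ₗ[k] R) (q : kˣ)
    (ρR : H →* (R ≃ₐ[k] R)) (ρS : H →* (S ≃ₐ[k] S)) : Prop where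
  isOreExtension : IsOreExtension ι x τ δ
  /-- `R` is left noetherian. -/
  noetherian_left : IsNoetherianRing R
  /-- `R` is right noetherian. -/
  noetherian_right : IsNoetherianRing Rᵐᵒᵖ
  locNilpotent : IsLocNilpotent δ
  q_comm : ∀ r : R, δ (τ r) = (q : k) • τ (δ r)
  q_notRootOfUnity : NotRootOfUnity (q : k)
  /-- The action on `S` restricts to the action on `R`. -/
  action_restrict : ∀ (h : H) (r : R), ρS h (ι r) = ι (ρR h r)
  /-- `x` is an `H`-eigenvector. -/
  eigenvector : ∀ h : H, ∃ c : k, ρS h x = c • x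
  /-- Some `h₀` acts on `R` as `τ`, and its eigenvalue on `x` is not a root of unity. -/
  exists_h₀ : ∃ h₀ : H, (∀ r : R, ρR h₀ r = τ r) ∧
    ∃ c : k, ρS h₀ x = c • x ∧ NotRootOfUnity c
  completelyPrime : ∀ P : TwoSidedIdeal R, IsHPrime ρR P → IsCompletelyPrime P

section Localization

variable {k R S : Type*} [Field k] [Ring R] [Algebra k R] [Ring S] [Algebra k S]
  {ι : R →ₐ[k] S} {x : S} {τ : R ≃ₐ[k] R} {δ : R →ₗ[k] R}

theorem IsOreExtension.eq_zero_of_mul_x (hO : IsOreExtension ι x τ δ) (s : S) (hs : s * x = 0) :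
    s = 0 := by
  obtain ⟨p, rfl⟩ := hO.bijective.2 s
  have h : (p.mapDomain Nat.succ) = 0 := by
    apply hO.bijective.1
    simp only [Finsupp.sum_zero_index]
    rw [Finsupp.sum_mapDomain_index (by simp) (by intros; simp [add_mul]), ← hs]
    simp only [Finsupp.sum, Finset.sum_mul, mul_assoc, ← pow_succ, Nat.succ_eq_add_one]
  have : p = 0 := Finsupp.mapDomain_injective Nat.succ_injective
    (by rw [h, Finsupp.mapDomain_zero])
  simp [this]

theorem IsOreExtension.ore_aux_base (hO : IsOreExtension ι x τ δ) (n : ℕ) :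
    ∀ r : R, (δ ^ n) r = 0 → ∃ t : S, x ^ n * ι r = t * x := by
  induction n with
  | zero => intro r hr; exact ⟨0, by simp at hr; simp [hr]⟩
  | succ n ih =>
    intro r hr
    obtain ⟨t, ht⟩ := ih (δ r) (by rw [pow_succ] at hr; exact hr)
    refine ⟨x ^ n * ι (τ r) + t, ?_⟩
    rw [pow_succ, mul_assoc, hO.comm, mul_add, ht, add_mul, mul_assoc]

theorem IsOreExtension.ore_aux_one (hO : IsOreExtension ι x τ δ) (hδ : IsLocNilpotent δ) (s : S) :
    ∃ (m : ℕ) (t : S), x ^ m * s = t * x := by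
  obtain ⟨p, rfl⟩ := hO.bijective.2 s
  dsimp only
  induction p using Finsupp.induction_linear with
  | zero => exact ⟨0, 0, by simp⟩
  | add f g hf hg =>
    obtain ⟨m, t, h⟩ := hf
    obtain ⟨m', t', h'⟩ := hg
    refine ⟨m' + m, x ^ m' * t + x ^ m * t', ?_⟩
    rw [Finsupp.sum_add_index' (by simp) (by intros; simp [add_mul]), mul_add, add_mul]
    congr 1
    · rw [pow_add, mul_assoc, h, mul_assoc]
    · rw [add_comm, pow_add, mul_assoc, h', mul_assoc]
  | single i r =>
    rw [Finsupp.sum_single_index (by simp)]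
    cases i with
    | zero =>
      obtain ⟨n, hn⟩ := hδ r
      obtain ⟨t, ht⟩ := hO.ore_aux_base n r hn
      exact ⟨n, t, by simpa using ht⟩
    | succ i => exact ⟨0, ι r * x ^ i, by rw [pow_succ]; simp [mul_assoc]⟩

theorem IsOreExtension.ore_aux (hO : IsOreExtension ι x τ δ) (hδ : IsLocNilpotent δ) (s : S)
    (n : ℕ) : ∃ (m : ℕ) (t : S), x ^ m * s = t * x ^ n := by
  induction n with
  | zero => exact ⟨0, s, by simp⟩
  | succ n ih =>
    obtain ⟨m, t, h⟩ := ih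
    obtain ⟨m', t', h'⟩ := hO.ore_aux_one hδ t
    exact ⟨m' + m, t', by
      rw [pow_add, mul_assoc, h, ← mul_assoc, h', mul_assoc, ← pow_succ']⟩

theorem IsOreExtension.ore_cond (hO : IsOreExtension ι x τ δ) (hδ : IsLocNilpotent δ) (s : S)
    (y : Submonoid.powers x) : ∃ (z : Submonoid.powers x) (t : S), (z : S) * s = t * y := by
  obtain ⟨_, n, rfl⟩ := y
  obtain ⟨m, t, h⟩ := hO.ore_aux hδ s n
  exact ⟨⟨x ^ m, m, rfl⟩, t, h⟩

/-- The powers of `x` form a denominator set in `R[x; τ, δ]` when `δ` is locally nilpotent. -/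
@[reducible] noncomputable def IsOreExtension.oreSet (hO : IsOreExtension ι x τ δ)
    (hδ : IsLocNilpotent δ) : OreLocalization.OreSet (Submonoid.powers x) where
  ore_right_cancel := by
    rintro a b ⟨_, n, rfl⟩ h
    refine ⟨1, ?_⟩
    suffices a = b by rw [this]
    dsimp only at h
    induction n with
    | zero => simpa using h
    | succ n ih =>
      refine ih (sub_eq_zero.1 (hO.eq_zero_of_mul_x _ ?_))
      rw [sub_mul, mul_assoc, mul_assoc, ← pow_succ, h, sub_self]
  oreNum s y := (hO.ore_cond hδ s y).choose_spec.choose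
  oreDenom s y := (hO.ore_cond hδ s y).choose
  ore_eq s y := (hO.ore_cond hδ s y).choose_spec.choose_spec

end Localization

/-- The `q`-factorial `(l)!_q = ∏_{i=1}^{l} (1 + q + ⋯ + q^{i-1})`. -/
def qFactorial {k : Type*} [Field k] (q : k) (l : ℕ) : k :=
  ∏ i ∈ Finset.range l, ∑ j ∈ Finset.range (i + 1), q ^ j

/-- The scalars `q_l = q^{l(l+1)/2} (q-1)^{-l} / (l)!_q`. -/
def cauchonScalar {k : Type*} [Field k] (q : k) (l : ℕ) : k :=
  q ^ (l * (l + 1) / 2) * ((q - 1) ^ l)⁻¹ / qFactorial q l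

namespace IsCauchonExtension

variable {k R S H : Type*} [Field k] [Ring R] [Algebra k R] [Ring S] [Algebra k S] [CommGroup H]
  {ι : R →ₐ[k] S} {x : S} {τ : R ≃ₐ[k] R} {δ : R →ₗ[k] R} {q : kˣ}
  {ρR : H →* (R ≃ₐ[k] R)} {ρS : H →* (S ≃ₐ[k] S)}

/-- The localization `L = S[x⁻¹]`. -/
def L (hS : IsCauchonExtension ι x τ δ q ρR ρS) : Type _ :=
  letI := hS.isOreExtension.oreSet hS.locNilpotent
  OreLocalization (Submonoid.powers x) S

noncomputable instance (hS : IsCauchonExtension ι x τ δ q ρR ρS) : Ring hS.L :=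
  letI := hS.isOreExtension.oreSet hS.locNilpotent
  (inferInstance : Ring (OreLocalization (Submonoid.powers x) S))

noncomputable instance (hS : IsCauchonExtension ι x τ δ q ρR ρS) : Algebra k hS.L :=
  letI := hS.isOreExtension.oreSet hS.locNilpotent
  (inferInstance : Algebra k (OreLocalization (Submonoid.powers x) S))

/-- The localization map `S → L`. -/
noncomputable def toL (hS : IsCauchonExtension ι x τ δ q ρR ρS) : S →+* hS.L :=
  letI := hS.isOreExtension.oreSet hS.locNilpotent
  (OreLocalization.numeratorRingHom : S →+* OreLocalization (Submonoid.powers x) S)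

/-- `x` as a unit of `L`. -/
noncomputable def xUnit (hS : IsCauchonExtension ι x τ δ q ρR ρS) : hS.Lˣ :=
  letI := hS.isOreExtension.oreSet hS.locNilpotent
  (OreLocalization.numeratorUnit ⟨x, Submonoid.mem_powers x⟩ :
    (OreLocalization (Submonoid.powers x) S)ˣ)

theorem coe_xUnit (hS : IsCauchonExtension ι x τ δ q ρR ρS) : (hS.xUnit : hS.L) = hS.toL x := rfl

/-- Cauchon's deleting-derivation map `C : R → L`,
`C(r) = ∑_{l ≥ 0} q_l δ^l(τ^{-l}(r)) x^{-l}`; only finitely many terms are nonzero. -/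
noncomputable def C (hS : IsCauchonExtension ι x τ δ q ρR ρS) (r : R) : hS.L :=
  ∑ᶠ l : ℕ, cauchonScalar (q : k) l •
    (hS.toL (ι ((δ ^ l) ((τ.symm ^ l) r))) * ((hS.xUnit⁻¹ ^ l : hS.Lˣ) : hS.L))

end IsCauchonExtension

/-! The map `C` is an injective ring homomorphism with x C(r) = C(τ(r)) x, and L is a skew Laurent
ring over C(R): each element is uniquely a finite sum of terms C(r) xⁱ. Let h₀ act on R as τ, with
eigenvalue c on x. The twist l ↦ x⁻¹ h₀(l) x fixes C(R) and multiplies xⁱ by cⁱ, and these scalars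
are distinct. This is used twice. First, C(r) is r plus terms of negative degree, so C(r)C(s) -
C(rs) is fixed by the twist and of negative degree, hence zero; no q-binomial identity is needed
(`C_mul`). Second, an H-stable ideal E of L is a sum of eigenspaces, so E = ⊕ C(P) xⁱ with P =
C⁻¹(E) (`C_mem_of_laurentSum_mem`). A leading term argument shows that ⟨C(P)⟩ is completely prime
when P is (`isCompletelyPrime_extIdeal`), so its contraction to S is H-prime.

It remains to show that an H-prime Q of S without x is contracted from L, that is, that x is regular
modulo Q on both sides. By noetherianity and H-primeness this follows once no power of x lies in Q
(`x_pow_notMem`). If δ(R) ⊆ Q, then x is normal modulo Q and H-primeness suffices. Otherwise some a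
has δ(a) ∉ Q and δ²(a) ∈ Q; moving a across xⁿ⁺¹, with the Ore condition in R/(Q ∩ R), turns an
element u xⁿ⁺¹ of Q into some u' xⁿ in Q, with u' again outside Q (`map_mul_x_pow_notMem`).

That descent needs Q ∩ R to be completely prime (`isCompletelyPrime_comap`). A maximality argument
exhibits Q ∩ R as the largest δ-stable ideal inside an H-prime P of R. As P is completely prime, so
is this core, by the top term of the q-Leibniz formula, whose coefficient is a nonzero q-binomial.
-/

/-! ### Hilbert's basis theorem for skew extensions -/

section HilbertBasis

variable {R S : Type*} [Ring R] [Ring S]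

/-- The sums `∑_{i < n} xⁱ f(aᵢ)`. -/
def powSpan (f : R →+* S) (x : S) : ℕ → AddSubgroup S
  | 0 => ⊥
  | n + 1 => powSpan f x n ⊔ ((AddMonoidHom.mulLeft (x ^ n)).comp f.toAddMonoidHom).range

variable {f : R →+* S} {x : S} {σ : R ≃+* R} {d : R → R}

theorem powSpan_le_succ (n : ℕ) : powSpan f x n ≤ powSpan f x (n + 1) := le_sup_left

theorem powSpan_mono : Monotone (powSpan f x) := monotone_nat_of_le_succ powSpan_le_succ

theorem pow_mul_mem_powSpan (n : ℕ) (a : R) : x ^ n * f a ∈ powSpan f x (n + 1) :=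
  (le_sup_right : _ ≤ powSpan f x (n + 1)) ⟨a, rfl⟩

theorem map_mem_powSpan (g : S →+ S) (e : ℕ)
    (hg : ∀ n a, g (x ^ n * f a) ∈ powSpan f x (n + 1 + e)) (n : ℕ) :
    ∀ s ∈ powSpan f x n, g s ∈ powSpan f x (n + e) := by
  induction n with
  | zero => intro s hs; rw [powSpan, AddSubgroup.mem_bot] at hs; simp [hs, zero_mem]
  | succ n ih =>
    intro s hs
    obtain ⟨t, ht, _, ⟨a, rfl⟩, rfl⟩ := AddSubgroup.mem_sup.1 hs
    rw [map_add]
    exact add_mem (powSpan_mono (by lia) (ih t ht)) (hg n a)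

theorem mul_mem_powSpan (n : ℕ) (a : R) : ∀ s ∈ powSpan f x n, s * f a ∈ powSpan f x n := by
  refine map_mem_powSpan (AddMonoidHom.mulRight (f a)) 0 (fun n b => ?_) n
  change x ^ n * f b * f a ∈ _
  rw [mul_assoc, ← map_mul]
  exact pow_mul_mem_powSpan _ _

theorem x_mul_mem_powSpan (n : ℕ) : ∀ s ∈ powSpan f x n, x * s ∈ powSpan f x (n + 1) := by
  refine map_mem_powSpan (AddMonoidHom.mulLeft x) 1 (fun n b => ?_) n
  change x * (x ^ n * f b) ∈ _
  rw [← mul_assoc, ← pow_succ']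
  exact pow_mul_mem_powSpan _ _

theorem mul_x_mem_powSpan (h : ∀ a, f a * x = x * f (σ a) + f (d a)) (n : ℕ) :
    ∀ s ∈ powSpan f x n, s * x ∈ powSpan f x (n + 1) := by
  refine map_mem_powSpan (AddMonoidHom.mulRight x) 1 (fun n b => ?_) n
  change x ^ n * f b * x ∈ _
  rw [mul_assoc, h, mul_add, ← mul_assoc, ← pow_succ]
  exact add_mem (pow_mul_mem_powSpan _ _) (powSpan_le_succ _ (pow_mul_mem_powSpan _ _))

/-- Each passage across one `x` applies `σ` and leaves a term of lower degree, so left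
multiplication by `a` acts on leading coefficients of degree `n` through `σ ^ n`. -/
theorem map_mul_pow_sub_mem_powSpan (h : ∀ a, f a * x = x * f (σ a) + f (d a)) (a : R) (n : ℕ) :
    f a * x ^ n - x ^ n * f ((σ ^ n) a) ∈ powSpan f x n := by
  induction n with
  | zero => simp [zero_mem]
  | succ n ih =>
    have h1 := add_mem (mul_x_mem_powSpan h _ _ ih) (pow_mul_mem_powSpan n (d ((σ ^ n) a)))
    convert h1 using 1
    rw [sub_mul, mul_assoc (x ^ n), h, mul_add, pow_succ x, pow_succ' σ, RingAut.mul_apply]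
    simp only [mul_assoc]
    abel

theorem map_mul_mem_powSpan (h : ∀ a, f a * x = x * f (σ a) + f (d a)) (a : R) (n : ℕ) :
    ∀ s ∈ powSpan f x n, f a * s ∈ powSpan f x n := by
  refine map_mem_powSpan (AddMonoidHom.mulLeft (f a)) 0 (fun n b => ?_) n
  change f a * (x ^ n * f b) ∈ _
  have h1 := mul_mem_powSpan n b _ (map_mul_pow_sub_mem_powSpan h a n)
  have h2 := add_mem (powSpan_le_succ _ h1) (pow_mul_mem_powSpan (f := f) (x := x) n ((σ ^ n) a * b))
  convert h2 using 1
  rw [map_mul]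
  noncomm_ring

/-- The left ideal of leading coefficients in degree `n` of the left ideal `I`. -/
def leadingIdeal (h : ∀ a, f a * x = x * f (σ a) + f (d a)) (I : Ideal S) (n : ℕ) : Ideal R where
  carrier := {a | ∃ s ∈ I, s - x ^ n * f a ∈ powSpan f x n}
  zero_mem' := ⟨0, I.zero_mem, by simp [zero_mem]⟩
  add_mem' := by
    rintro a b ⟨s, hs, hs'⟩ ⟨t, ht, ht'⟩
    refine ⟨s + t, I.add_mem hs ht, ?_⟩
    convert add_mem hs' ht' using 1
    rw [map_add, mul_add]; abel
  smul_mem' := by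
    rintro r a ⟨s, hs, hs'⟩
    -- Multiplying by `f r` multiplies the leading coefficient by `(σ ^ n) r`; surjectivity of `σ ^
    -- n` makes every scalar of this form.
    obtain ⟨r, rfl⟩ := (σ ^ n).surjective r
    refine ⟨f r * s, I.mul_mem_left _ hs, ?_⟩
    convert add_mem (map_mul_mem_powSpan h r n _ hs')
      (mul_mem_powSpan n a _ (map_mul_pow_sub_mem_powSpan h r n)) using 1
    rw [smul_eq_mul, map_mul]
    noncomm_ring

theorem leadingIdeal_mono (h : ∀ a, f a * x = x * f (σ a) + f (d a)) {I J : Ideal S} (hIJ : I ≤ J)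
    (n : ℕ) : leadingIdeal h I n ≤ leadingIdeal h J n := fun _ ⟨s, hs, hs'⟩ => ⟨s, hIJ hs, hs'⟩

theorem leadingIdeal_monotone (h : ∀ a, f a * x = x * f (σ a) + f (d a)) (I : Ideal S) :
    Monotone (leadingIdeal h I) := by
  refine monotone_nat_of_le_succ fun n a ⟨s, hs, hs'⟩ => ⟨x * s, I.mul_mem_left _ hs, ?_⟩
  convert x_mul_mem_powSpan n _ hs' using 1
  rw [pow_succ', mul_sub, mul_assoc]

theorem exists_fg_leadingIdeal_le_of_noetherian [IsNoetherianRing R]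
    (h : ∀ a, f a * x = x * f (σ a) + f (d a)) (I : Ideal S) (n : ℕ) :
    ∃ J : Ideal S, J.FG ∧ J ≤ I ∧ leadingIdeal h I n ≤ leadingIdeal h J n := by
  obtain ⟨T, hT⟩ := IsNoetherian.noetherian (leadingIdeal h I n)
  have hs : ∀ a : T, ∃ s ∈ I, s - x ^ n * f a ∈ powSpan f x n := fun a => by
    have : (a : R) ∈ leadingIdeal h I n := hT ▸ Submodule.subset_span a.2
    exact this
  choose g hg hg' using hs
  refine ⟨Ideal.span (Set.range g), Submodule.fg_span (Set.finite_range g), ?_, ?_⟩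
  · rw [Ideal.span_le]
    rintro _ ⟨a, rfl⟩
    exact hg a
  · rw [← hT, Submodule.span_le]
    intro a ha
    exact ⟨g ⟨a, ha⟩, Ideal.subset_span ⟨_, rfl⟩, hg' ⟨a, ha⟩⟩

/-- The leading ideals increase with the degree and stabilize at some `N`, so generators for degrees
up to `N` serve all degrees. -/
theorem exists_fg_forall_leadingIdeal_le_of_noetherian [IsNoetherianRing R]
    (h : ∀ a, f a * x = x * f (σ a) + f (d a)) (I : Ideal S) :
    ∃ J : Ideal S, J.FG ∧ J ≤ I ∧ ∀ n, leadingIdeal h I n ≤ leadingIdeal h J n := by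
  choose J hfg hJ hle using exists_fg_leadingIdeal_le_of_noetherian h I
  obtain ⟨N, hN⟩ := monotone_stabilizes_iff_noetherian.2 ‹IsNoetherianRing R›
    ⟨leadingIdeal h I, leadingIdeal_monotone h I⟩
  refine ⟨(Finset.range (N + 1)).sup J, Submodule.fg_finset_sup _ _ fun i _ => hfg i,
    Finset.sup_le fun i _ => hJ i, fun n => ?_⟩
  have key : ∀ m ≤ N, leadingIdeal h I m ≤ leadingIdeal h ((Finset.range (N + 1)).sup J) m :=
    fun m hm => (hle m).trans (leadingIdeal_mono h (Finset.le_sup (by simpa [Nat.lt_succ_iff])) m)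
  rcases le_total n N with hn | hn
  · exact key n hn
  · have := hN n hn
    dsimp at this
    rw [← this]
    exact (key N le_rfl).trans (leadingIdeal_monotone h _ hn)

/-- Hilbert's basis theorem for rings generated by a noetherian ring and an element that
normalizes it up to terms of degree zero. -/
theorem isNoetherianRing_of_skew_comm [IsNoetherianRing R]
    (h : ∀ a, f a * x = x * f (σ a) + f (d a))
    (hgen : ∀ A : AddSubgroup S, 1 ∈ A → (∀ a, ∀ s ∈ A, f a * s ∈ A) → (∀ s ∈ A, x * s ∈ A) →
      ∀ s, s ∈ A) : IsNoetherianRing S := by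
  refine ⟨fun I => ?_⟩
  obtain ⟨J, hfg, hJ, hle⟩ := exists_fg_forall_leadingIdeal_le_of_noetherian h I
  have key : ∀ n, ∀ s ∈ powSpan f x n, s ∈ I → s ∈ J := by
    intro n
    induction n with
    | zero => intro s hs _; rw [powSpan, AddSubgroup.mem_bot] at hs; exact hs ▸ J.zero_mem
    | succ n ih =>
      intro s hs hsI
      obtain ⟨t, ht, _, ⟨a, rfl⟩, rfl⟩ := AddSubgroup.mem_sup.1 hs
      -- `u` lies in `J` and has the same leading coefficient, so subtracting it lowers the degree.
      obtain ⟨u, hu, hu'⟩ := hle n (show a ∈ leadingIdeal h I n from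
        ⟨_, hsI, by convert ht using 1; exact add_sub_cancel_right _ _⟩)
      have h1 := ih _ (sub_mem ht hu') (by
        convert sub_mem hsI (hJ hu) using 1
        change _ = t + x ^ n * f a - u
        abel)
      convert add_mem h1 hu using 1
      change t + x ^ n * f a = _
      abel
  have hdir : Directed (· ≤ ·) (powSpan f x) := powSpan_mono.directed_le
  have hall : ∀ s, ∃ n, s ∈ powSpan f x n := by
    intro s
    have := hgen (⨆ n, powSpan f x n)
      ((AddSubgroup.mem_iSup_of_directed hdir).2 ⟨1, by
        simpa using pow_mul_mem_powSpan (f := f) (x := x) 0 1⟩)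
      (fun a s hs => by
        rw [AddSubgroup.mem_iSup_of_directed hdir] at hs ⊢
        exact hs.imp fun n hn => map_mul_mem_powSpan h a n s hn)
      (fun s hs => by
        rw [AddSubgroup.mem_iSup_of_directed hdir] at hs ⊢
        obtain ⟨n, hn⟩ := hs
        exact ⟨n + 1, x_mul_mem_powSpan n s hn⟩) s
    rwa [AddSubgroup.mem_iSup_of_directed hdir] at this
  have : I = J := le_antisymm (fun s hs => (hall s).elim fun n hn => key n s hn hs) hJ
  exact this ▸ hfg

end HilbertBasis

/-! ### The Ore extension is left and right noetherian -/

section OreNoetherian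

variable {k R S : Type*} [Field k] [Ring R] [Algebra k R] [Ring S] [Algebra k S]
  {ι : R →ₐ[k] S} {x : S} {τ : R ≃ₐ[k] R} {δ : R →ₗ[k] R}

namespace IsOreExtension

theorem map_mul_x (hO : IsOreExtension ι x τ δ) (r : R) :
    ι r * x = x * ι (τ.symm r) + ι (-δ (τ.symm r)) := by
  rw [hO.comm]; simp

/-- An additive subgroup containing all `r xⁱ` is everything. -/
theorem mem_of_forall_mul_pow (hO : IsOreExtension ι x τ δ) (A : AddSubgroup S)
    (h : ∀ r i, ι r * x ^ i ∈ A) (s : S) : s ∈ A := by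
  obtain ⟨p, rfl⟩ := hO.bijective.2 s
  exact sum_mem fun i _ => h _ i

theorem isNoetherianRing (hO : IsOreExtension ι x τ δ) [IsNoetherianRing R] :
    IsNoetherianRing S := by
  refine isNoetherianRing_of_skew_comm (f := (ι : R →+* S)) (x := x)
    (σ := (τ.symm : R ≃+* R)) (d := fun r => -δ (τ.symm r)) hO.map_mul_x
    fun A h1 hR hx s => hO.mem_of_forall_mul_pow A (fun r i => hR r _ ?_) s
  induction i with
  | zero => simpa
  | succ i ih => rw [pow_succ']; exact hx _ ih

/-- Read in the opposite ring, the rule x r = τ(r) x + δ(r) already has the shape required by the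
basis theorem, with σ = τ and no inverse. -/
theorem isNoetherianRing_op (hO : IsOreExtension ι x τ δ) [IsNoetherianRing Rᵐᵒᵖ] :
    IsNoetherianRing Sᵐᵒᵖ := by
  refine isNoetherianRing_of_skew_comm (f := (ι : R →+* S).op) (x := MulOpposite.op x)
    (σ := RingEquiv.op (τ : R ≃+* R)) (d := fun r => MulOpposite.op (δ r.unop)) ?_ ?_
  · intro a
    exact congrArg MulOpposite.op (hO.comm a.unop)
  · intro A h1 hR hx s
    refine hO.mem_of_forall_mul_pow
      (A.comap (MulOpposite.opAddEquiv : S ≃+ Sᵐᵒᵖ).toAddMonoidHom) (fun r i => ?_) s.unop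
    change MulOpposite.op (ι r * x ^ i) ∈ A
    induction i with
    | zero => simpa using hR (MulOpposite.op r) 1 h1
    | succ i ih => rw [pow_succ, ← mul_assoc]; exact hx _ ih

end IsOreExtension

end OreNoetherian

/-! ### Two-sided ideals and H-prime ideals -/

namespace TwoSidedIdeal

variable {k A : Type*} [Field k] [Ring A] [Algebra k A] (I : TwoSidedIdeal A)

theorem algebra_smul_mem (c : k) {a : A} (ha : a ∈ I) : c • a ∈ I := by
  rw [Algebra.smul_def]; exact I.mul_mem_left _ _ ha

theorem algebra_smul_mem_iff {c : k} (hc : c ≠ 0) {a : A} : c • a ∈ I ↔ a ∈ I :=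
  ⟨fun h => by simpa [smul_smul, hc] using I.algebra_smul_mem c⁻¹ h, I.algebra_smul_mem c⟩

theorem eq_top_of_one_mem {I : TwoSidedIdeal A} (h : (1 : A) ∈ I) : I = ⊤ :=
  top_le_iff.1 fun a _ => by simpa using I.mul_mem_left a 1 h

/-- If `X A Y ⊆ Q` then `⟨X⟩ ⟨Y⟩ ⊆ Q`. -/
theorem forall_mul_mem_of_forall_mul_mul_mem {Q : TwoSidedIdeal A} {X Y : Set A}
    (h : ∀ a ∈ X, ∀ b ∈ Y, ∀ s, a * s * b ∈ Q) : ∀ a ∈ span X, ∀ b ∈ span Y, a * b ∈ Q := by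
  -- The factor `s` in the middle makes `U` closed under right multiplication. Once `span X` lies in
  -- `U`, the set `V` of right multipliers into `Q` is a two-sided ideal because `span X` is one.
  let U : TwoSidedIdeal A := .mk' {u | ∀ s, ∀ b ∈ Y, u * s * b ∈ Q}
    (by simp [Q.zero_mem]) (fun hu hv s b hb => by
      simpa only [add_mul] using Q.add_mem (hu s b hb) (hv s b hb))
    (fun hu s b hb => by simpa only [neg_mul] using Q.neg_mem (hu s b hb))
    (fun {t u} hu s b hb => by
      simpa only [mul_assoc] using Q.mul_mem_left t _ (hu s b hb))
    (fun {u t} hu s b hb => by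
      simpa only [mul_assoc] using hu (t * s) b hb)
  have hU : span X ≤ U := span_le.2 fun a ha => by
    simpa [U] using fun s b hb => h a ha b hb s
  let V : TwoSidedIdeal A := .mk' {v | ∀ u ∈ span X, u * v ∈ Q}
    (by simp [Q.zero_mem]) (fun hu hv a ha => by
      simpa only [mul_add] using Q.add_mem (hu a ha) (hv a ha))
    (fun hu a ha => by simpa only [mul_neg] using Q.neg_mem (hu a ha))
    (fun {t v} hv a ha => by
      simpa only [mul_assoc] using hv (a * t) ((span X).mul_mem_right _ _ ha))
    (fun {v t} hv a ha => by
      simpa only [mul_assoc] using Q.mul_mem_right _ t (hv a ha))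
  have hV : span Y ≤ V := span_le.2 fun b hb => by
    have : ∀ u ∈ span X, u * b ∈ Q := fun u hu => by
      have := hU hu
      simp only [U, mem_mk', Set.mem_ofPred_eq] at this
      simpa using this 1 b hb
    simpa [V] using this
  intro a ha b hb
  have := hV hb
  simp only [V, mem_mk', Set.mem_ofPred_eq] at this
  exact this a ha

theorem exists_maximal_of_noetherian [IsNoetherianRing A] (X : Set (TwoSidedIdeal A))
    (hX : X.Nonempty) : ∃ P ∈ X, ∀ I ∈ X, ¬ P < I := by
  obtain ⟨_, ⟨P, hP, rfl⟩, h⟩ := set_has_maximal_iff_noetherian.2 ‹IsNoetherianRing A›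
    (asIdeal '' X) (hX.image _)
  refine ⟨P, hP, fun I hI hlt => h _ ⟨I, hI, rfl⟩ ?_⟩
  exact hlt

end TwoSidedIdeal

section HSpec

variable {k A H : Type*} [Field k] [Ring A] [Algebra k A] [Group H] {ρ : H →* (A ≃ₐ[k] A)}

theorem isHStable_span {X : Set A} (hX : ∀ h, ∀ a ∈ X, ρ h a ∈ TwoSidedIdeal.span X) :
    IsHStable ρ (TwoSidedIdeal.span X) := fun h a ha => by
  have : TwoSidedIdeal.span X ≤ (TwoSidedIdeal.span X).comap (ρ h : A →+* A) :=
    TwoSidedIdeal.span_le.2 fun a ha => (TwoSidedIdeal.mem_comap _).2 (hX h a ha)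
  exact (TwoSidedIdeal.mem_comap _).1 (this ha)

/-- H-primeness in the form used below: it can be tested on generating sets that are only stable up
to the ideals they span, such as a power of the eigenvector `x`. -/
theorem IsHPrime.subset_or_subset {Q : TwoSidedIdeal A} (hQ : IsHPrime ρ Q) {X Y : Set A}
    (hX : ∀ h, ∀ a ∈ X, ρ h a ∈ TwoSidedIdeal.span X)
    (hY : ∀ h, ∀ a ∈ Y, ρ h a ∈ TwoSidedIdeal.span Y)
    (h : ∀ a ∈ X, ∀ b ∈ Y, ∀ s, a * s * b ∈ Q) : X ⊆ Q ∨ Y ⊆ Q := by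
  rw [← TwoSidedIdeal.span_le, ← TwoSidedIdeal.span_le]
  exact hQ.prime _ _ (isHStable_span hX) (isHStable_span hY)
    (TwoSidedIdeal.forall_mul_mem_of_forall_mul_mul_mem h)

theorem IsHPrime.one_notMem {Q : TwoSidedIdeal A} (hQ : IsHPrime ρ Q) : (1 : A) ∉ Q :=
  fun h => hQ.ne_top (TwoSidedIdeal.eq_top_of_one_mem h)

theorem IsCompletelyPrime.isHPrime {P : TwoSidedIdeal A} (hP : IsCompletelyPrime P)
    (hs : IsHStable ρ P) : IsHPrime ρ P := by
  refine ⟨hP.1, hs, fun I J _ _ h => ?_⟩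
  by_contra! hc
  obtain ⟨a, ha, ha'⟩ := SetLike.not_le_iff_exists.1 hc.1
  obtain ⟨b, hb, hb'⟩ := SetLike.not_le_iff_exists.1 hc.2
  exact (hP.2 a b (h a ha b hb)).elim ha' hb'

theorem IsHStable.mem_iff {I : TwoSidedIdeal A} (hI : IsHStable ρ I) (h : H) {a : A} :
    ρ h a ∈ I ↔ a ∈ I := by
  refine ⟨fun ha => ?_, hI h a⟩
  have := hI h⁻¹ _ ha
  rwa [← AlgEquiv.mul_apply, ← map_mul, inv_mul_cancel, map_one, AlgEquiv.one_apply] at this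

end HSpec

/-! ### q-numbers and q-factorials -/

section QNumbers

variable {k : Type*} [Field k] {q : k}

/-- The `q`-number `1 + q + ⋯ + q^{n-1}`. -/
def qNumber (q : k) (n : ℕ) : k := ∑ j ∈ Finset.range n, q ^ j

theorem qFactorial_zero : qFactorial q 0 = 1 := by simp [qFactorial]

theorem qFactorial_succ (n : ℕ) : qFactorial q (n + 1) = qNumber q (n + 1) * qFactorial q n := by
  rw [qFactorial, Finset.prod_range_succ, mul_comm]; rfl

theorem qNumber_succ (n : ℕ) : qNumber q (n + 1) = qNumber q n + q ^ n :=
  Finset.sum_range_succ _ _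

theorem qNumber_add (m n : ℕ) : qNumber q (m + n) = qNumber q m + q ^ m * qNumber q n := by
  simp [qNumber, Finset.sum_range_add, pow_add, Finset.mul_sum]

theorem NotRootOfUnity.sub_one_ne_zero (hq : NotRootOfUnity q) : q - 1 ≠ 0 := by
  simpa [sub_eq_zero] using hq 1 one_pos

theorem NotRootOfUnity.qNumber_ne_zero (hq : NotRootOfUnity q) (n : ℕ) : qNumber q (n + 1) ≠ 0 := by
  intro h
  have := mul_geom_sum q (n + 1)
  rw [← qNumber, h, mul_zero, eq_comm, sub_eq_zero] at this
  exact hq _ n.succ_pos this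

theorem NotRootOfUnity.qFactorial_ne_zero (hq : NotRootOfUnity q) (n : ℕ) :
    qFactorial q n ≠ 0 := by
  induction n with
  | zero => simp [qFactorial_zero]
  | succ n ih => rw [qFactorial_succ]; exact mul_ne_zero (hq.qNumber_ne_zero n) ih

end QNumbers

/-! ### Coefficients in the Ore extension -/

namespace IsOreExtension

variable {k R S : Type*} [Field k] [Ring R] [Algebra k R] [Ring S] [Algebra k S]
  {ι : R →ₐ[k] S} {x : S} {τ : R ≃ₐ[k] R} {δ : R →ₗ[k] R}

/-- The coefficients of an element of the Ore extension. -/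
noncomputable def coeff (hO : IsOreExtension ι x τ δ) : S ≃+ (ℕ →₀ R) :=
  (AddEquiv.ofBijective
    (Finsupp.liftAddHom fun i => (AddMonoidHom.mulRight (x ^ i)).comp (ι : R →+ S))
    hO.bijective).symm

theorem coeff_symm_apply (hO : IsOreExtension ι x τ δ) (p : ℕ →₀ R) :
    hO.coeff.symm p = p.sum fun i r => ι r * x ^ i := rfl

theorem coeff_mul_pow (hO : IsOreExtension ι x τ δ) (r : R) (i : ℕ) :
    hO.coeff (ι r * x ^ i) = Finsupp.single i r := by
  rw [← AddEquiv.eq_symm_apply, coeff_symm_apply, Finsupp.sum_single_index (by simp)]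

theorem coeff_map (hO : IsOreExtension ι x τ δ) (r : R) :
    hO.coeff (ι r) = Finsupp.single 0 r := by simpa using hO.coeff_mul_pow r 0

theorem coeff_mul_x (hO : IsOreExtension ι x τ δ) (r : R) :
    hO.coeff (ι r * x) = Finsupp.single 1 r := by simpa using hO.coeff_mul_pow r 1

theorem eq_of_mul_x_add (hO : IsOreExtension ι x τ δ) {a b a' b' : R}
    (h : ι a * x + ι b = ι a' * x + ι b') : a = a' ∧ b = b' := by
  have := congrArg hO.coeff h
  rw [map_add, map_add, coeff_map, coeff_map, coeff_mul_x, coeff_mul_x] at this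
  exact ⟨by simpa using DFunLike.congr_fun this 1, by simpa using DFunLike.congr_fun this 0⟩

theorem subsingleton_of_x_eq_zero (hO : IsOreExtension ι x τ δ) (hx : x = 0) : Subsingleton S := by
  have h1 : hO.coeff (ι 1 * x ^ 1) = 0 := by simp [hx]
  rw [coeff_mul_pow] at h1
  have h2 : (1 : R) = 0 := by simpa using h1
  have h3 : (1 : S) = 0 := by simpa using congrArg ι h2
  exact subsingleton_of_zero_eq_one h3.symm

end IsOreExtension

/-! ### Commutation of the H-action with τ and δ -/

namespace IsCauchonExtension

variable {k R S H : Type*} [Field k] [Ring R] [Algebra k R] [Ring S] [Algebra k S] [CommGroup H]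
  {ι : R →ₐ[k] S} {x : S} {τ : R ≃ₐ[k] R} {δ : R →ₗ[k] R} {q : kˣ}
  {ρR : H →* (R ≃ₐ[k] R)} {ρS : H →* (S ≃ₐ[k] S)}

/-- An eigenvalue 0 forces x = 0 by injectivity of the action, and then any unit serves as
eigenvalue. -/
theorem exists_unit_eigenvalue (hS : IsCauchonExtension ι x τ δ q ρR ρS) (h : H) :
    ∃ c : kˣ, ρS h x = (c : k) • x := by
  obtain ⟨c, hc⟩ := hS.eigenvector h
  rcases eq_or_ne c 0 with rfl | h0
  · have hx : x = 0 := (ρS h).injective (by simpa using hc)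
    exact ⟨1, by simp [hx]⟩
  · exact ⟨Units.mk0 c h0, hc⟩

/-- Apply `h` to the commutation rule for x r and compare coefficients with the rule for x h(r). -/
theorem action_comm (hS : IsCauchonExtension ι x τ δ q ρR ρS) {h : H} {c : kˣ}
    (hc : ρS h x = (c : k) • x) (r : R) :
    ρR h (τ r) = τ (ρR h r) ∧ ρR h (δ r) = (c : k) • δ (ρR h r) := by
  have h1 := congrArg (ρS h) (hS.isOreExtension.comm r)
  have h4 : ι ((c : k) • τ (ρR h r)) * x + ι ((c : k) • δ (ρR h r)) =
      ι ((c : k) • ρR h (τ r)) * x + ι (ρR h (δ r)) := by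
    rw [map_mul, map_add, map_mul, hc, hS.action_restrict, hS.action_restrict, hS.action_restrict,
      smul_mul_assoc, hS.isOreExtension.comm, smul_add, mul_smul_comm] at h1
    simpa using h1
  obtain ⟨h2, h3⟩ := hS.isOreExtension.eq_of_mul_x_add h4
  exact ⟨((smul_right_injective _ c.ne_zero) h2).symm, h3.symm⟩

theorem action_tau (hS : IsCauchonExtension ι x τ δ q ρR ρS) (h : H) (r : R) :
    ρR h (τ r) = τ (ρR h r) :=
  (hS.exists_unit_eigenvalue h).elim fun _ hc => (hS.action_comm hc r).1

theorem action_tau_symm (hS : IsCauchonExtension ι x τ δ q ρR ρS) (h : H) (r : R) :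
    ρR h (τ.symm r) = τ.symm (ρR h r) := by
  rw [AlgEquiv.eq_symm_apply, ← hS.action_tau, AlgEquiv.apply_symm_apply]

theorem action_delta_pow (hS : IsCauchonExtension ι x τ δ q ρR ρS) {h : H} {c : kˣ}
    (hc : ρS h x = (c : k) • x) (n : ℕ) (r : R) :
    ρR h ((δ ^ n) r) = (c : k) ^ n • (δ ^ n) (ρR h r) := by
  induction n generalizing r with
  | zero => simp
  | succ n ih =>
    rw [pow_succ, Module.End.mul_apply, ih, (hS.action_comm hc r).2, map_smul, smul_smul,
      ← pow_succ, Module.End.mul_apply]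

theorem delta_tau_pow (hS : IsCauchonExtension ι x τ δ q ρR ρS) (n : ℕ) (r : R) :
    δ ((τ ^ n) r) = (q : k) ^ n • (τ ^ n) (δ r) := by
  induction n generalizing r with
  | zero => simp
  | succ n ih =>
    rw [pow_succ, AlgEquiv.mul_apply, ih, hS.q_comm, map_smul, smul_smul, ← pow_succ,
      AlgEquiv.mul_apply]

theorem delta_pow_tau (hS : IsCauchonExtension ι x τ δ q ρR ρS) (n : ℕ) (r : R) :
    (δ ^ n) (τ r) = (q : k) ^ n • τ ((δ ^ n) r) := by
  induction n generalizing r with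
  | zero => simp
  | succ n ih =>
    rw [pow_succ, Module.End.mul_apply, hS.q_comm, map_smul, ih, smul_smul, ← pow_succ',
      Module.End.mul_apply]

theorem tau_mem_iff (hS : IsCauchonExtension ι x τ δ q ρR ρS) {I : TwoSidedIdeal R}
    (hI : IsHStable ρR I) {r : R} : τ r ∈ I ↔ r ∈ I := by
  obtain ⟨h, hh, -⟩ := hS.exists_h₀
  rw [← hh, hI.mem_iff]

theorem tau_pow_mem_iff (hS : IsCauchonExtension ι x τ δ q ρR ρS) {I : TwoSidedIdeal R}
    (hI : IsHStable ρR I) (n : ℕ) {r : R} : (τ ^ n) r ∈ I ↔ r ∈ I := by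
  induction n with
  | zero => simp
  | succ n ih => rw [pow_succ', AlgEquiv.mul_apply, hS.tau_mem_iff hI, ih]

/-! ### The largest δ-stable ideal inside an H-stable ideal -/

section Core

variable {I : TwoSidedIdeal R}

theorem delta_pow_mul_mem_left (hS : IsCauchonExtension ι x τ δ q ρR ρS) {r : R}
    (hr : ∀ j, (δ ^ j) r ∈ I) (a : R) (j : ℕ) : (δ ^ j) (a * r) ∈ I := by
  induction j generalizing a r with
  | zero => simpa using I.mul_mem_left a r (hr 0)
  | succ j ih =>
    rw [pow_succ, Module.End.mul_apply, hS.isOreExtension.leibniz, map_add]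
    exact I.add_mem (ih (fun i => by simpa [pow_succ] using hr (i + 1)) _) (ih hr _)

theorem delta_pow_mul_mem_right (hS : IsCauchonExtension ι x τ δ q ρR ρS) (hI : IsHStable ρR I)
    {r : R} (hr : ∀ j, (δ ^ j) r ∈ I) (a : R) (j : ℕ) : (δ ^ j) (r * a) ∈ I := by
  induction j generalizing a r with
  | zero => simpa using I.mul_mem_right r a (hr 0)
  | succ j ih =>
    rw [pow_succ, Module.End.mul_apply, hS.isOreExtension.leibniz, map_add]
    refine I.add_mem (ih (fun i => ?_) _) (ih (fun i => by simpa [pow_succ] using hr (i + 1)) _)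
    rw [hS.delta_pow_tau]
    exact I.algebra_smul_mem _ ((hS.tau_mem_iff hI).2 (hr i))

/-- The largest `δ`-stable ideal contained in an `H`-stable ideal. -/
def deltaCore (hS : IsCauchonExtension ι x τ δ q ρR ρS) (I : TwoSidedIdeal R)
    (hI : IsHStable ρR I) : TwoSidedIdeal R :=
  .mk' {r | ∀ j, (δ ^ j) r ∈ I} (by simp [I.zero_mem])
    (fun ha hb j => by simpa using I.add_mem (ha j) (hb j))
    (fun ha j => by simpa using I.neg_mem (ha j))
    (fun hr => hS.delta_pow_mul_mem_left hr _) (fun hr => hS.delta_pow_mul_mem_right hI hr _)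

theorem mem_deltaCore (hS : IsCauchonExtension ι x τ δ q ρR ρS) (hI : IsHStable ρR I) {r : R} :
    r ∈ hS.deltaCore I hI ↔ ∀ j, (δ ^ j) r ∈ I := by simp [deltaCore]

theorem deltaCore_le (hS : IsCauchonExtension ι x τ δ q ρR ρS) (hI : IsHStable ρR I) :
    hS.deltaCore I hI ≤ I := fun r hr => by simpa using (hS.mem_deltaCore hI).1 hr 0

theorem isHStable_deltaCore (hS : IsCauchonExtension ι x τ δ q ρR ρS) (hI : IsHStable ρR I) :
    IsHStable ρR (hS.deltaCore I hI) := fun h r hr => by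
  obtain ⟨c, hc⟩ := hS.exists_unit_eigenvalue h
  rw [mem_deltaCore] at hr ⊢
  intro j
  have := hI h _ (hr j)
  rw [hS.action_delta_pow hc] at this
  exact (I.algebra_smul_mem_iff (pow_ne_zero _ c.ne_zero)).1 this

theorem delta_mem_deltaCore (hS : IsCauchonExtension ι x τ δ q ρR ρS) (hI : IsHStable ρR I) {r : R}
    (hr : r ∈ hS.deltaCore I hI) : δ r ∈ hS.deltaCore I hI := by
  rw [mem_deltaCore] at hr ⊢
  exact fun j => by simpa [pow_succ] using hr (j + 1)

theorem le_deltaCore (hS : IsCauchonExtension ι x τ δ q ρR ρS) (hI : IsHStable ρR I)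
    {J : TwoSidedIdeal R} (hJI : J ≤ I) (hJ : ∀ r ∈ J, δ r ∈ J) : J ≤ hS.deltaCore I hI := by
  intro r hr
  rw [mem_deltaCore]
  have : ∀ j, (δ ^ j) r ∈ J := by
    intro j
    induction j with
    | zero => simpa
    | succ j ih => rw [pow_succ']; exact hJ _ ih
  exact fun j => hJI (this j)

/-- In the q-Leibniz expansion of δ^(i+j)(ab) every other term contains some δ^m(a) with m > i or
some δ^m(b) with m > j, and so lies in `I`. The surviving coefficient is a q-binomial; multiplying
by the two q-factorials avoids division and lets q-Pascal run as an induction on `i` and `j`. -/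
theorem qFactorial_smul_delta_pow_mul_sub_mem (hS : IsCauchonExtension ι x τ δ q ρR ρS)
    (hI : IsHStable ρR I) (i j : ℕ) (a b : R) (ha : ∀ m, i < m → (δ ^ m) a ∈ I)
    (hb : ∀ m, j < m → (δ ^ m) b ∈ I) :
    (qFactorial (q : k) i * qFactorial (q : k) j) • (δ ^ (i + j)) (a * b) -
      qFactorial (q : k) (i + j) • ((τ ^ j) ((δ ^ i) a) * (δ ^ j) b) ∈ I := by
  have hshift : ∀ (n : ℕ) (r : R), (∀ m, n + 1 < m → (δ ^ m) r ∈ I) →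
      ∀ m, n < m → (δ ^ m) (δ r) ∈ I := fun n r hr m hm => by
    simpa [pow_succ] using hr (m + 1) (by lia)
  have htau : ∀ (n : ℕ) (r : R), (∀ m, n < m → (δ ^ m) r ∈ I) →
      ∀ m, n < m → (δ ^ m) (τ r) ∈ I := fun n r hr m hm => by
    rw [hS.delta_pow_tau]
    exact I.algebra_smul_mem _ ((hS.tau_mem_iff hI).2 (hr m hm))
  have hcore : ∀ r : R, (∀ m, 0 < m → (δ ^ m) r ∈ I) → ∀ m, (δ ^ m) (δ r) ∈ I := fun r hr m => by
    simpa [pow_succ] using hr (m + 1) (by lia)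
  have hsplit : ∀ (n : ℕ) (a b : R),
      (δ ^ (n + 1)) (a * b) = (δ ^ n) (τ a * δ b) + (δ ^ n) (δ a * b) := fun n a b => by
    rw [pow_succ, Module.End.mul_apply, hS.isOreExtension.leibniz, map_add]
  induction i generalizing j a b with
  | zero =>
    induction j generalizing a b with
    | zero => simp [qFactorial_zero, I.zero_mem]
    | succ j ih =>
      have h1 := ih (τ a) (δ b) (htau 0 a ha) (hshift j b hb)
      -- For `i = 0` all derivatives of `δ a` lie in `I`, so the summand `δ a * b` of the Leibniz
      -- rule contributes nothing modulo `I`.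
      have h2 := hS.delta_pow_mul_mem_right hI (hcore a ha) b (0 + j)
      have h3 := I.add_mem (I.algebra_smul_mem (qNumber (q : k) (j + 1)) h1)
        (I.algebra_smul_mem (qFactorial (q : k) 0 * qFactorial (q : k) (j + 1)) h2)
      convert h3 using 1
      rw [← add_assoc, hsplit, qFactorial_zero]
      simp only [zero_add, one_mul, pow_zero, Module.End.one_apply, qFactorial_succ, pow_succ,
        Module.End.mul_apply, AlgEquiv.mul_apply]
      module
  | succ i ihi =>
    induction j generalizing a b with
    | zero =>
      have h1 := ihi 0 (δ a) b (hshift i a ha) hb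
      have h2 := hS.delta_pow_mul_mem_left (hcore b hb) (τ a) (i + 0)
      have h3 := I.add_mem (I.algebra_smul_mem (qNumber (q : k) (i + 1)) h1)
        (I.algebra_smul_mem (qFactorial (q : k) (i + 1) * qFactorial (q : k) 0) h2)
      convert h3 using 1
      rw [add_right_comm, hsplit, qFactorial_zero]
      simp only [add_zero, mul_one, pow_zero, Module.End.one_apply, qFactorial_succ, pow_succ,
        Module.End.mul_apply, AlgEquiv.one_apply]
      module
    | succ j ihj =>
      have h1 := ihj (τ a) (δ b) (htau _ a ha) (hshift j b hb)
      have h2 := ihi (j + 1) (δ a) b (hshift i a ha) hb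
      have h3 := I.add_mem (I.algebra_smul_mem (qNumber (q : k) (j + 1)) h1)
        (I.algebra_smul_mem (qNumber (q : k) (i + 1)) h2)
      convert h3 using 1
      have e1 : i + 1 + (j + 1) = (i + 1 + j) + 1 := by lia
      have e2 : i + (j + 1) = i + 1 + j := by lia
      -- The q-Pascal step: the summand `τ a * δ b` brings the factor `q ^ (i + 1)` from commuting
      -- `δ ^ (i + 1)` with `τ`.
      have e3 : qNumber (q : k) (i + 1 + j + 1) =
          qNumber (q : k) (i + 1) + (q : k) ^ (i + 1) * qNumber (q : k) (j + 1) := by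
        rw [← qNumber_add]; rfl
      rw [e1, e2, hsplit, qFactorial_succ (i + 1 + j), e3, hS.delta_pow_tau]
      simp only [qFactorial_succ, pow_succ τ, pow_succ δ, Module.End.mul_apply,
        AlgEquiv.mul_apply, map_smul, smul_mul_assoc]
      module

/-- The largest `δ`-stable ideal inside a completely prime ideal is completely prime. -/
theorem isCompletelyPrime_deltaCore (hS : IsCauchonExtension ι x τ δ q ρR ρS)
    (hI : IsHStable ρR I) (hp : IsCompletelyPrime I) : IsCompletelyPrime (hS.deltaCore I hI) := by
  refine ⟨fun h => hp.1 (top_le_iff.1 (h ▸ hS.deltaCore_le hI)), fun a b hab => ?_⟩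
  -- Local nilpotence gives each element outside the core a last derivative outside `I`; the formula
  -- is applied at these two orders.
  have hmax : ∀ r ∉ hS.deltaCore I hI, ∃ i, (δ ^ i) r ∉ I ∧ ∀ m, i < m → (δ ^ m) r ∈ I := by
    classical
    intro r hr
    rw [mem_deltaCore, not_forall] at hr
    obtain ⟨i, hi⟩ := hr
    obtain ⟨n, hn⟩ := hS.locNilpotent r
    have hbd : ∀ m, (δ ^ m) r ∉ I → m ≤ n := fun m hm => by
      by_contra! hlt
      apply hm
      rw [← Nat.sub_add_cancel hlt.le, pow_add, Module.End.mul_apply, hn, map_zero]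
      exact I.zero_mem
    refine ⟨Nat.findGreatest (fun m => (δ ^ m) r ∉ I) n,
      Nat.findGreatest_spec (P := fun m => (δ ^ m) r ∉ I) (hbd i hi) hi, fun m hm => ?_⟩
    by_contra hc
    exact absurd (Nat.le_findGreatest (P := fun m => (δ ^ m) r ∉ I) (hbd m hc) hc) hm.not_ge
  by_contra! hc
  obtain ⟨i, hi, hi'⟩ := hmax a hc.1
  obtain ⟨j, hj, hj'⟩ := hmax b hc.2
  have h1 := hS.qFactorial_smul_delta_pow_mul_sub_mem hI i j a b hi' hj'
  have h2 := I.sub_mem (I.algebra_smul_mem (qFactorial (q : k) i * qFactorial (q : k) j)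
    ((hS.mem_deltaCore hI).1 hab (i + j))) h1
  rw [sub_sub_cancel,
    I.algebra_smul_mem_iff (hS.q_notRootOfUnity.qFactorial_ne_zero _)] at h2
  exact (hp.2 _ _ h2).elim (fun h => hi ((hS.tau_pow_mem_iff hI j).1 h)) hj

end Core

/-! ### Contracting H-primes of S to R -/

section Contraction

variable {Q : TwoSidedIdeal S}

theorem isHStable_comap (hS : IsCauchonExtension ι x τ δ q ρR ρS) (hQ : IsHStable ρS Q) :
    IsHStable ρR (Q.comap ι) := fun h r hr => by
  rw [TwoSidedIdeal.mem_comap] at hr ⊢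
  rw [← hS.action_restrict]
  exact hQ h _ hr

theorem delta_mem_comap (hS : IsCauchonExtension ι x τ δ q ρR ρS) (hQ : IsHStable ρS Q) {r : R}
    (hr : r ∈ Q.comap ι) : δ r ∈ Q.comap ι := by
  have h1 := (hS.tau_mem_iff (hS.isHStable_comap hQ)).2 hr
  rw [TwoSidedIdeal.mem_comap] at *
  rw [← add_sub_cancel_left (ι (τ r) * x) (ι (δ r)), ← hS.isOreExtension.comm]
  exact Q.sub_mem (Q.mul_mem_left _ _ hr) (Q.mul_mem_right _ _ h1)

/-- Since `J` is stable under τ and δ, powers of `x` can be moved to the right across it, so I S J ⊆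
(I J) S ⊆ Q. -/
theorem mul_mul_mem_of_stable (hS : IsCauchonExtension ι x τ δ q ρR ρS) {I J : TwoSidedIdeal R}
    (hJ : IsHStable ρR J) (hJδ : ∀ r ∈ J, δ r ∈ J)
    (h : ∀ a ∈ I, ∀ b ∈ J, a * b ∈ Q.comap ι) {a b : R} (ha : a ∈ I) (hb : b ∈ J) (s : S) :
    ι a * s * ι b ∈ Q := by
  have key : ∀ i, ∀ a ∈ I, ∀ b ∈ J, ι a * x ^ i * ι b ∈ Q := by
    intro i
    induction i with
    | zero => intro a ha b hb; simpa [TwoSidedIdeal.mem_comap] using h a ha b hb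
    | succ i ih =>
      intro a ha b hb
      have h1 := Q.mul_mem_right _ x (ih a ha (τ b) ((hS.tau_mem_iff hJ).2 hb))
      have h2 := ih a ha (δ b) (hJδ b hb)
      convert Q.add_mem h1 h2 using 1
      rw [pow_succ, mul_assoc, mul_assoc (x ^ i), hS.isOreExtension.comm]
      noncomm_ring
  let A : AddSubgroup S :=
    { carrier := {s | ι a * s * ι b ∈ Q}
      zero_mem' := by simp [Q.zero_mem]
      add_mem' := fun hs ht => by
        simpa only [Set.mem_ofPred_eq, mul_add, add_mul] using Q.add_mem hs ht
      neg_mem' := fun hs => by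
        simpa only [Set.mem_ofPred_eq, mul_neg, neg_mul] using Q.neg_mem hs }
  refine hS.isOreExtension.mem_of_forall_mul_pow A (fun r i => ?_) s
  change ι a * (ι r * x ^ i) * ι b ∈ Q
  rw [← mul_assoc, ← map_mul]
  exact key i _ (I.mul_mem_right _ _ ha) b hb

theorem le_or_le_of_mul_le_comap (hS : IsCauchonExtension ι x τ δ q ρR ρS) (hQ : IsHPrime ρS Q)
    {I J : TwoSidedIdeal R} (hI : IsHStable ρR I) (hJ : IsHStable ρR J) (hJδ : ∀ r ∈ J, δ r ∈ J)
    (h : ∀ a ∈ I, ∀ b ∈ J, a * b ∈ Q.comap ι) : I ≤ Q.comap ι ∨ J ≤ Q.comap ι := by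
  have hst : ∀ I : TwoSidedIdeal R, IsHStable ρR I →
      ∀ h, ∀ a ∈ ι '' {r | r ∈ I}, ρS h a ∈ TwoSidedIdeal.span (ι '' {r | r ∈ I}) := by
    rintro I hI h _ ⟨a, ha, rfl⟩
    rw [hS.action_restrict]
    exact TwoSidedIdeal.subset_span ⟨_, hI h a ha, rfl⟩
  refine (hQ.subset_or_subset (hst I hI) (hst J hJ) ?_).imp ?_ ?_
  · rintro _ ⟨a, ha, rfl⟩ _ ⟨b, hb, rfl⟩ s
    exact hS.mul_mul_mem_of_stable hJ hJδ h ha hb s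
  all_goals exact fun hsub r hr => (TwoSidedIdeal.mem_comap _).2 (hsub ⟨r, hr, rfl⟩)

/-- `H`-prime ideals of `S` contract to completely prime ideals of `R`. -/
theorem isCompletelyPrime_comap (hS : IsCauchonExtension ι x τ δ q ρR ρS) (hQ : IsHPrime ρS Q) :
    IsCompletelyPrime (Q.comap ι) := by
  have := hS.noetherian_left
  have h0 := hS.isHStable_comap hQ.stable
  -- The core of `P` is exactly Q ∩ R, because Q ∩ R is itself δ-stable. Maximality will make `P`
  -- H-prime, hence completely prime by hypothesis, and the core inherits this.
  obtain ⟨P, ⟨hP, hP0, hPcore⟩, hmax⟩ := TwoSidedIdeal.exists_maximal_of_noetherian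
    {I : TwoSidedIdeal R | ∃ hI : IsHStable ρR I, Q.comap ι ≤ I ∧ hS.deltaCore I hI ≤ Q.comap ι}
    ⟨_, h0, le_rfl, hS.deltaCore_le h0⟩
  have heq : hS.deltaCore P hP = Q.comap ι :=
    le_antisymm hPcore (hS.le_deltaCore hP hP0 fun r => hS.delta_mem_comap hQ.stable)
  rw [← heq]
  refine hS.isCompletelyPrime_deltaCore hP (hS.completelyPrime P ⟨?_, hP, fun I J hI hJ hIJ => ?_⟩)
  · rintro rfl
    apply hQ.one_notMem
    have : (1 : R) ∈ Q.comap ι := hPcore ((hS.mem_deltaCore hP).2 fun j => trivial)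
    simpa [TwoSidedIdeal.mem_comap] using this
  · by_contra! hc
    have hsup : ∀ I : TwoSidedIdeal R, IsHStable ρR I → IsHStable ρR (I ⊔ P) := by
      intro I hI h a ha
      obtain ⟨y, hy, z, hz, rfl⟩ := TwoSidedIdeal.mem_sup.1 ha
      rw [map_add]
      exact TwoSidedIdeal.mem_sup.2 ⟨_, hI h _ hy, _, hP h _ hz, rfl⟩
    have hnot : ∀ (I : TwoSidedIdeal R) (hI : IsHStable ρR I), ¬ I ≤ P →
        ¬ hS.deltaCore (I ⊔ P) (hsup I hI) ≤ Q.comap ι := fun I hI hIP hle =>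
      hmax (I ⊔ P) ⟨hsup I hI, hP0.trans le_sup_right, hle⟩ (right_lt_sup.2 hIP)
    -- By maximality neither core of the enlarged ideals lies in Q ∩ R, so it contradicts
    -- H-primeness of `Q` that their product does.
    refine (hS.le_or_le_of_mul_le_comap hQ (hS.isHStable_deltaCore (hsup I hI))
      (hS.isHStable_deltaCore (hsup J hJ)) (fun r => hS.delta_mem_deltaCore _) ?_).elim
      (hnot I hI hc.1) (hnot J hJ hc.2)
    have hprod : ∀ a ∈ I ⊔ P, ∀ b ∈ J ⊔ P, a * b ∈ P := by
      intro a ha b hb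
      obtain ⟨y, hy, z, hz, rfl⟩ := TwoSidedIdeal.mem_sup.1 ha
      obtain ⟨u, hu, v, hv, rfl⟩ := TwoSidedIdeal.mem_sup.1 hb
      rw [mul_add, add_mul]
      exact P.add_mem (P.add_mem (hIJ y hy u hu) (P.mul_mem_right _ _ hz)) (P.mul_mem_left _ _ hv)
    intro a ha b hb
    rw [← heq, mem_deltaCore]
    intro j
    -- The cores are stable under τ and δ, so the Leibniz rule keeps every term a product of
    -- elements of the two cores, and such products lie in `P`.
    induction j generalizing a b with
    | zero => simpa using hprod a (hS.deltaCore_le _ ha) b (hS.deltaCore_le _ hb)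
    | succ j ih =>
      rw [pow_succ, Module.End.mul_apply, hS.isOreExtension.leibniz, map_add]
      exact P.add_mem
        (ih _ ((hS.tau_mem_iff (hS.isHStable_deltaCore _)).2 ha) _ (hS.delta_mem_deltaCore _ hb))
        (ih _ (hS.delta_mem_deltaCore _ ha) _ hb)

end Contraction

end IsCauchonExtension

/-- The quotient A/P is a left noetherian domain, hence satisfies the left Ore condition. -/
theorem IsCompletelyPrime.exists_mul_sub_mul_mem {A : Type*} [Ring A] [IsNoetherianRing A]
    {P : TwoSidedIdeal A} (hP : IsCompletelyPrime P) (u v : A) (hu : u ∉ P) :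
    ∃ b d, b ∉ P ∧ b * v - d * u ∈ P := by
  let D := P.ringCon.Quotient
  let π : A →+* D := P.ringCon.mk'
  have hπ : Function.Surjective π := Quotient.mk''_surjective
  have hker : ∀ a, π a = 0 ↔ a ∈ P := fun a => by
    rw [TwoSidedIdeal.mem_iff]
    exact RingCon.eq _
  have : IsNoetherianRing D := isNoetherianRing_of_surjective A D π hπ
  have : Nontrivial D := ⟨⟨π 1, 0, fun h => hP.1 (by
    refine top_le_iff.1 fun a _ => ?_
    simpa using P.mul_mem_left a 1 ((hker 1).1 h))⟩⟩
  have : NoZeroDivisors D := ⟨fun {a b} h => by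
    obtain ⟨a, rfl⟩ := hπ a
    obtain ⟨b, rfl⟩ := hπ b
    rw [← map_mul, hker] at h
    simpa only [hker] using hP.2 a b h⟩
  have : IsDomain D := NoZeroDivisors.to_isDomain D
  obtain ⟨hO⟩ := nonempty_oreSet_of_strongRankCondition (R := D)
  obtain ⟨e, s, h⟩ := (OreLocalization.nonempty_oreSet_iff_of_noZeroDivisors
    (S := nonZeroDivisors D)).1 ⟨hO⟩ (π v)
    ⟨π u, mem_nonZeroDivisors_of_ne_zero fun h => hu ((hker u).1 h)⟩
  obtain ⟨d, rfl⟩ := hπ e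
  obtain ⟨b, hb⟩ := hπ (s : D)
  refine ⟨b, d, fun h0 => nonZeroDivisors.ne_zero s.2 (hb ▸ (hker b).2 h0), ?_⟩
  rw [← hker, map_sub, map_mul, map_mul, hb, h, sub_self]

/-! ### Regularity of x modulo an H-prime -/

namespace IsCauchonExtension

variable {k R S H : Type*} [Field k] [Ring R] [Algebra k R] [Ring S] [Algebra k S] [CommGroup H]
  {ι : R →ₐ[k] S} {x : S} {τ : R ≃ₐ[k] R} {δ : R →ₗ[k] R} {q : kˣ}
  {ρR : H →* (R ≃ₐ[k] R)} {ρS : H →* (S ≃ₐ[k] S)} {Q : TwoSidedIdeal S}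

/-- Modulo `Q` all terms with δ² vanish. The variable `x` passes `a` with one factor applying δ and
the others τ, and reordering by δτ = qτδ sums the coefficients to the q-number. -/
theorem x_pow_mul_sub_mem (hS : IsCauchonExtension ι x τ δ q ρR ρS) (hQ : IsHStable ρS Q) {a : R}
    (ha : δ (δ a) ∈ Q.comap ι) (n : ℕ) :
    x ^ (n + 1) * ι a - (ι ((τ ^ (n + 1)) a) * x ^ (n + 1) +
      qNumber (q : k) (n + 1) • (ι ((τ ^ n) (δ a)) * x ^ n)) ∈ Q := by
  induction n with
  | zero => simp [qNumber, hS.isOreExtension.comm, Q.zero_mem]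
  | succ n ih =>
    have h1 : ι (δ ((τ ^ n) (δ a))) ∈ Q := by
      rw [← TwoSidedIdeal.mem_comap, hS.delta_tau_pow]
      exact TwoSidedIdeal.algebra_smul_mem _ _ ((hS.tau_pow_mem_iff (hS.isHStable_comap hQ) n).2 ha)
    convert Q.add_mem (Q.mul_mem_left x _ ih) (Q.algebra_smul_mem (qNumber (q : k) (n + 1))
      (Q.mul_mem_right _ (x ^ n) h1)) using 1
    have e : ∀ r : R, ∀ m, x * (ι r * x ^ m) = ι (τ r) * x ^ (m + 1) + ι (δ r) * x ^ m := by
      intro r m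
      rw [← mul_assoc, hS.isOreExtension.comm, add_mul, mul_assoc, pow_succ']
    rw [mul_sub, mul_add, mul_smul_comm, e, e, ← mul_assoc, ← pow_succ', hS.delta_tau_pow,
      qNumber_succ (n + 1), ← AlgEquiv.mul_apply τ, ← pow_succ', ← AlgEquiv.mul_apply τ,
      ← pow_succ', map_smul, smul_mul_assoc]
    module

/-- Descent on the exponent: if u xⁿ⁺¹ ∈ Q, right multiplication by `a` gives a term in xⁿ⁺¹ and one
in xⁿ. The former is removed using the original element, and complete primeness of Q ∩ R keeps the
coefficient of the latter outside `Q`. -/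
theorem map_mul_x_pow_notMem (hS : IsCauchonExtension ι x τ δ q ρR ρS) (hQ : IsHPrime ρS Q) {a : R}
    (ha : δ a ∉ Q.comap ι) (ha' : δ (δ a) ∈ Q.comap ι) (n : ℕ) (u : R) (hu : u ∉ Q.comap ι) :
    ι u * x ^ n ∉ Q := by
  have := hS.noetherian_left
  have hcp := hS.isCompletelyPrime_comap hQ
  have hst := hS.isHStable_comap hQ.stable
  induction n generalizing u with
  | zero => simpa [TwoSidedIdeal.mem_comap] using hu
  | succ n ih =>
    intro h
    -- The Ore condition makes `b * u * (τ ^ (n + 1)) a` congruent to `d * u`, a left multiple of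
    -- `u`, so its product with `x ^ (n + 1)` lies in `Q`.
    obtain ⟨b, d, hb, hbd⟩ := hcp.exists_mul_sub_mul_mem u (u * (τ ^ (n + 1)) a) hu
    refine ih (b * (u * (τ ^ n) (δ a))) (fun hmem => ?_) ?_
    · exact (hcp.2 _ _ hmem).elim hb fun hmem => (hcp.2 _ _ hmem).elim hu fun hmem =>
        ha ((hS.tau_pow_mem_iff hst n).1 hmem)
    · have h1 := Q.mul_mem_left (ι (b * u)) _ (hS.x_pow_mul_sub_mem hQ.stable ha' n)
      have h2 := Q.mul_mem_left (ι b) _ (Q.mul_mem_right _ (ι a) h)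
      have h3 := Q.mul_mem_left (ι d) _ h
      have h4 := Q.mul_mem_right _ (x ^ (n + 1)) ((TwoSidedIdeal.mem_comap _).1 hbd)
      rw [← Q.algebra_smul_mem_iff (hS.q_notRootOfUnity.qNumber_ne_zero n)]
      convert Q.sub_mem (Q.sub_mem (Q.sub_mem h2 h1) h4) h3 using 1
      simp only [map_mul, map_sub, mul_sub, sub_mul, mul_add, mul_smul_comm, mul_assoc]
      abel

theorem action_x_pow (hS : IsCauchonExtension ι x τ δ q ρR ρS) (h : H) (n : ℕ) :
    ∃ c : k, c ≠ 0 ∧ ρS h (x ^ n) = c • x ^ n := by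
  obtain ⟨c, hc⟩ := hS.exists_unit_eigenvalue h
  exact ⟨(c : k) ^ n, pow_ne_zero _ c.ne_zero, by rw [map_pow, hc, smul_pow]⟩

theorem action_x_pow_mem_span (hS : IsCauchonExtension ι x τ δ q ρR ρS) (n : ℕ) (h : H) :
    ∀ a ∈ ({x ^ n} : Set S), ρS h a ∈ TwoSidedIdeal.span {x ^ n} := by
  rintro _ rfl
  obtain ⟨c, -, hc⟩ := hS.action_x_pow h n
  rw [hc]
  exact TwoSidedIdeal.algebra_smul_mem _ _ (TwoSidedIdeal.subset_span rfl)

theorem action_mul_x_pow_mem (hS : IsCauchonExtension ι x τ δ q ρR ρS) (hQ : IsHStable ρS Q)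
    (h : H) {n : ℕ} {s : S} (hs : s * x ^ n ∈ Q) : ρS h s * x ^ n ∈ Q := by
  obtain ⟨c, hc0, hc⟩ := hS.action_x_pow h n
  have := hQ h _ hs
  rwa [map_mul, hc, mul_smul_comm, Q.algebra_smul_mem_iff hc0] at this

theorem x_pow_mul_action_mem (hS : IsCauchonExtension ι x τ δ q ρR ρS) (hQ : IsHStable ρS Q)
    (h : H) {n : ℕ} {s : S} (hs : x ^ n * s ∈ Q) : x ^ n * ρS h s ∈ Q := by
  obtain ⟨c, hc0, hc⟩ := hS.action_x_pow h n
  have := hQ h _ hs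
  rwa [map_mul, hc, smul_mul_assoc, Q.algebra_smul_mem_iff hc0] at this

/-- Modulo `Q` the element `x` is normal, so s x ∈ Q gives s S x ⊆ Q, and H-primeness applies. -/
theorem mem_of_mul_x_mem_of_delta_mem (hS : IsCauchonExtension ι x τ δ q ρR ρS)
    (hQ : IsHPrime ρS Q) (hx : x ∉ Q) (hδ : ∀ r, ι (δ r) ∈ Q) {s : S} (hs : s * x ∈ Q) :
    s ∈ Q := by
  have hXY := hQ.subset_or_subset (X := {s | s * x ∈ Q}) (Y := {x})
    (fun h a ha => TwoSidedIdeal.subset_span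
      (by simpa using hS.action_mul_x_pow_mem hQ.stable h (n := 1) (by simpa using ha)))
    (by simpa using hS.action_x_pow_mem_span 1) ?_
  · exact (hXY.resolve_right fun h => hx (h rfl)) hs
  · rintro a ha y hy s
    rw [show y = x from hy]
    refine hS.isOreExtension.mem_of_forall_mul_pow
      ((AddSubgroup.ofClass Q).comap
        ((AddMonoidHom.mulRight x).comp (AddMonoidHom.mulLeft a))) (fun r i => ?_) s
    change a * (ι r * x ^ i) * x ∈ Q
    have h1 := Q.mul_mem_right _ (ι (τ.symm r) * x ^ i) ha
    have h2 := Q.mul_mem_right _ (x ^ i) (Q.mul_mem_left a _ (hδ (τ.symm r)))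
    convert Q.sub_mem h1 h2 using 1
    rw [mul_assoc, mul_assoc, ← pow_succ, pow_succ', ← mul_assoc (ι r), hS.isOreExtension.map_mul_x,
      map_neg]
    noncomm_ring

/-- An `H`-prime ideal of `S` without `x` contains no power of `x`. -/
theorem x_pow_notMem (hS : IsCauchonExtension ι x τ δ q ρR ρS) (hQ : IsHPrime ρS Q) (hx : x ∉ Q)
    (n : ℕ) : x ^ n ∉ Q := by
  classical
  by_cases hδ : ∀ r, ι (δ r) ∈ Q
  · induction n with
    | zero => simpa using hQ.one_notMem
    | succ n ih =>
      rw [pow_succ]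
      exact fun h => ih (hS.mem_of_mul_x_mem_of_delta_mem hQ hx hδ h)
  · push Not at hδ
    obtain ⟨r, hr⟩ := hδ
    have hex : ∃ m, (δ ^ m) (δ r) ∈ Q.comap ι :=
      (hS.locNilpotent (δ r)).imp fun m hm => by rw [hm]; exact zero_mem _
    -- The least exponent is positive because δ(r) ∉ Q; its predecessor `m` gives the element `a =
    -- (δ ^ m) r` with δ(a) ∉ Q and δ²(a) ∈ Q.
    obtain ⟨m, hm⟩ : ∃ m, Nat.find hex = m + 1 := Nat.exists_eq_succ_of_ne_zero fun h0 =>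
      hr ((TwoSidedIdeal.mem_comap _).1 ((Nat.find_eq_zero hex).1 h0))
    have h1 : δ ((δ ^ m) r) ∉ Q.comap ι := by
      rw [← Module.End.mul_apply, ← pow_succ', pow_succ, Module.End.mul_apply]
      exact Nat.find_min hex (by lia)
    have h2 : δ (δ ((δ ^ m) r)) ∈ Q.comap ι := by
      rw [← Module.End.mul_apply δ (δ ^ m), ← pow_succ', ← Module.End.mul_apply, ← pow_succ',
        pow_succ, Module.End.mul_apply, ← hm]
      exact Nat.find_spec hex
    simpa using hS.map_mul_x_pow_notMem hQ h1 h2 n 1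
      (by simpa [TwoSidedIdeal.mem_comap] using hQ.one_notMem)

/-- Pulling one `x` out to the left leaves a remainder with coefficient δ(τ⁻¹(r)), whose order of
nilpotency is smaller. -/
theorem exists_mul_x_pow_map (hS : IsCauchonExtension ι x τ δ q ρR ρS) (n : ℕ) :
    ∀ r, (δ ^ n) r = 0 → ∃ t, ι r * x ^ n = x * t := by
  induction n with
  | zero => intro r hr; exact ⟨0, by simp at hr; simp [hr]⟩
  | succ n ih =>
    intro r hr
    have h0 : (δ ^ n) (δ (τ.symm r)) = 0 := by
      have h1 := hS.delta_pow_tau (n + 1) (τ.symm r)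
      rw [AlgEquiv.apply_symm_apply, hr, eq_comm, smul_eq_zero_iff_right
        (pow_ne_zero _ q.ne_zero), map_eq_zero_iff _ τ.injective, pow_succ] at h1
      exact h1
    obtain ⟨t, ht⟩ := ih _ h0
    refine ⟨ι (τ.symm r) * x ^ n - t, ?_⟩
    rw [pow_succ', ← mul_assoc, hS.isOreExtension.map_mul_x, add_mul, map_neg, neg_mul, ht,
      mul_assoc, mul_sub, sub_eq_add_neg]

theorem exists_mul_x_pow_eq_x_mul (hS : IsCauchonExtension ι x τ δ q ρR ρS) (s : S) :
    ∃ (m : ℕ) (t : S), s * x ^ m = x * t := by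
  let A : AddSubgroup S :=
    { carrier := {s | ∃ (m : ℕ) (t : S), s * x ^ m = x * t}
      zero_mem' := ⟨0, 0, by simp⟩
      add_mem' := by
        rintro a b ⟨m, t, h⟩ ⟨n, u, h'⟩
        refine ⟨m + n, t * x ^ n + u * x ^ m, ?_⟩
        rw [add_mul, pow_add, ← mul_assoc, h, ← pow_add, add_comm m n, pow_add, ← mul_assoc, h',
          mul_add, mul_assoc, mul_assoc]
      neg_mem' := by
        rintro a ⟨m, t, h⟩
        exact ⟨m, -t, by rw [neg_mul, h, mul_neg]⟩ }
  refine hS.isOreExtension.mem_of_forall_mul_pow A (fun r i => ?_) s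
  obtain ⟨n, hn⟩ := hS.locNilpotent r
  obtain ⟨t, ht⟩ := hS.exists_mul_x_pow_map n r hn
  exact ⟨n, t * x ^ i, by
    rw [mul_assoc, ← pow_add, add_comm, pow_add, ← mul_assoc, ht, mul_assoc]⟩

/-- The right Ore condition for the powers of `x`. -/
theorem exists_mul_x_pow_eq_x_pow_mul (hS : IsCauchonExtension ι x τ δ q ρR ρS) (s : S) (n : ℕ) :
    ∃ (m : ℕ) (t : S), s * x ^ m = x ^ n * t := by
  induction n with
  | zero => exact ⟨0, s, by simp⟩
  | succ n ih =>
    obtain ⟨m, t, h⟩ := ih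
    obtain ⟨m', t', h'⟩ := hS.exists_mul_x_pow_eq_x_mul t
    exact ⟨m + m', t', by rw [pow_add, ← mul_assoc, h, mul_assoc, h', ← mul_assoc, ← pow_succ]⟩

/-- By noetherianity a single power x^N kills all left x-torsion modulo `Q`. The Ore condition then
gives x^N S b ⊆ Q for each torsion element b, and x^N ∉ Q. -/
theorem mem_of_x_pow_mul_mem (hS : IsCauchonExtension ι x τ δ q ρR ρS) (hQ : IsHPrime ρS Q)
    (hx : x ∉ Q) {n : ℕ} {s : S} (hs : x ^ n * s ∈ Q) : s ∈ Q := by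
  have := hS.noetherian_right
  have := hS.isOreExtension.isNoetherianRing_op
  -- The sets {s | xⁿ s ∈ Q} are right ideals, so the chain lives in the opposite ring.
  let K : ℕ →o Ideal Sᵐᵒᵖ :=
    { toFun := fun n => Submodule.comap
        (LinearMap.mulRight Sᵐᵒᵖ (MulOpposite.op (x ^ n)))
        (TwoSidedIdeal.asIdealOpposite Q)
      monotone' := monotone_nat_of_le_succ fun n s hs => by
        simp only [Submodule.mem_comap, LinearMap.mulRight_apply,
          TwoSidedIdeal.mem_asIdealOpposite, MulOpposite.unop_mul, MulOpposite.unop_op] at hs ⊢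
        rw [pow_succ', mul_assoc]
        exact Q.mul_mem_left _ _ hs }
  have hK : ∀ n s, MulOpposite.op s ∈ K n ↔ x ^ n * s ∈ Q := fun n s => by
    change _ ∈ TwoSidedIdeal.asIdealOpposite Q ↔ _
    rw [TwoSidedIdeal.mem_asIdealOpposite]; rfl
  obtain ⟨N, hN⟩ := monotone_stabilizes_iff_noetherian.2 this K
  have hN' : ∀ n s, x ^ n * s ∈ Q → x ^ N * s ∈ Q := fun n s h => by
    rw [← hK, hN (max N n) (le_max_left _ _)]
    exact K.monotone (le_max_right N n) ((hK n s).2 h)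
  have hXY := hQ.subset_or_subset (X := {x ^ N}) (Y := {s | ∃ n, x ^ n * s ∈ Q})
    (hS.action_x_pow_mem_span N) (fun h b ⟨n, hb⟩ => TwoSidedIdeal.subset_span
      ⟨n, hS.x_pow_mul_action_mem hQ.stable h hb⟩) ?_
  · exact (hXY.resolve_left fun h => hS.x_pow_notMem hQ hx N (h rfl)) ⟨n, hs⟩
  · rintro _ rfl b ⟨n, hb⟩ s
    obtain ⟨m, t, h⟩ := hS.isOreExtension.ore_aux hS.locNilpotent s n
    rw [mul_assoc]
    refine hN' m _ ?_
    rw [← mul_assoc, h, mul_assoc]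
    exact Q.mul_mem_left _ _ hb

theorem mem_of_mul_x_pow_mem (hS : IsCauchonExtension ι x τ δ q ρR ρS) (hQ : IsHPrime ρS Q)
    (hx : x ∉ Q) {n : ℕ} {s : S} (hs : s * x ^ n ∈ Q) : s ∈ Q := by
  have := hS.noetherian_left
  have := hS.isOreExtension.isNoetherianRing
  let K : ℕ →o Ideal S :=
    { toFun := fun n => Submodule.comap (LinearMap.mulRight S (x ^ n)) (TwoSidedIdeal.asIdeal Q)
      monotone' := monotone_nat_of_le_succ fun n s hs => by
        simp only [Submodule.mem_comap, LinearMap.mulRight_apply,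
          TwoSidedIdeal.mem_asIdeal] at hs ⊢
        rw [pow_succ, ← mul_assoc]
        exact Q.mul_mem_right _ _ hs }
  have hK : ∀ n s, s ∈ K n ↔ s * x ^ n ∈ Q := fun n s => Iff.rfl
  obtain ⟨N, hN⟩ := monotone_stabilizes_iff_noetherian.2 this K
  have hN' : ∀ n s, s * x ^ n ∈ Q → s * x ^ N ∈ Q := fun n s h => by
    rw [← hK, hN (max N n) (le_max_left _ _)]
    exact K.monotone (le_max_right N n) ((hK n s).2 h)
  have hXY := hQ.subset_or_subset (X := {s | ∃ n, s * x ^ n ∈ Q}) (Y := {x ^ N})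
    (fun h b ⟨n, hb⟩ => TwoSidedIdeal.subset_span
      ⟨n, hS.action_mul_x_pow_mem hQ.stable h hb⟩) (hS.action_x_pow_mem_span N) ?_
  · exact (hXY.resolve_right fun h => hS.x_pow_notMem hQ hx N (h rfl)) ⟨n, hs⟩
  · rintro b ⟨n, hb⟩ _ rfl s
    obtain ⟨m, t, h⟩ := hS.exists_mul_x_pow_eq_x_pow_mul s n
    refine hN' m _ ?_
    rw [mul_assoc, h, ← mul_assoc]
    exact Q.mul_mem_right _ _ hb

end IsCauchonExtension

/-! ### Top coefficients -/

namespace IsOreExtension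

variable {k R S : Type*} [Field k] [Ring R] [Algebra k R] [Ring S] [Algebra k S]
  {ι : R →ₐ[k] S} {x : S} {τ : R ≃ₐ[k] R} {δ : R →ₗ[k] R}

/-- Additive maps on `S` agree if they agree on all `r xⁱ`. -/
theorem addMonoidHom_ext (hO : IsOreExtension ι x τ δ) {M : Type*} [AddGroup M] {f g : S →+ M}
    (h : ∀ r i, f (ι r * x ^ i) = g (ι r * x ^ i)) (s : S) : f s = g s :=
  hO.mem_of_forall_mul_pow (f.eqLocus g) h s

theorem coeff_x_mul (hO : IsOreExtension ι x τ δ) (s : S) (m : ℕ) :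
    hO.coeff (x * s) (m + 1) = τ (hO.coeff s m) + δ (hO.coeff s (m + 1)) := by
  refine hO.addMonoidHom_ext
    (f := ((Finsupp.applyAddHom (m + 1)).comp hO.coeff.toAddMonoidHom).comp (AddMonoidHom.mulLeft x))
    (g := ((τ : R →+ R).comp (Finsupp.applyAddHom m) +
      δ.toAddMonoidHom.comp (Finsupp.applyAddHom (m + 1))).comp hO.coeff.toAddMonoidHom)
    (fun r i => ?_) s
  change hO.coeff (x * (ι r * x ^ i)) (m + 1) =
    τ (hO.coeff (ι r * x ^ i) m) + δ (hO.coeff (ι r * x ^ i) (m + 1))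
  rw [← mul_assoc, hO.comm, add_mul, mul_assoc, ← pow_succ', map_add hO.coeff, coeff_mul_pow,
    coeff_mul_pow, coeff_mul_pow, Finsupp.add_apply]
  simp only [Finsupp.single_apply, Nat.add_right_cancel_iff, apply_ite τ, apply_ite δ, map_zero]

theorem coeff_mul_x_succ (hO : IsOreExtension ι x τ δ) (s : S) (m : ℕ) :
    hO.coeff (s * x) (m + 1) = hO.coeff s m := by
  refine hO.addMonoidHom_ext
    (f := ((Finsupp.applyAddHom (m + 1)).comp hO.coeff.toAddMonoidHom).comp (AddMonoidHom.mulRight x))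
    (g := (Finsupp.applyAddHom m).comp hO.coeff.toAddMonoidHom) (fun r i => ?_) s
  change hO.coeff (ι r * x ^ i * x) (m + 1) = hO.coeff (ι r * x ^ i) m
  rw [mul_assoc, ← pow_succ, coeff_mul_pow, coeff_mul_pow]
  simp only [Finsupp.single_apply, Nat.add_right_cancel_iff]

theorem exists_top_coeff (hO : IsOreExtension ι x τ δ) {s : S} (hs : s ≠ 0) :
    ∃ m, hO.coeff s m ≠ 0 ∧ ∀ i, m < i → hO.coeff s i = 0 := by
  have hne : (hO.coeff s).support.Nonempty := by
    simpa [Finsupp.support_nonempty_iff] using hs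
  refine ⟨_, Finsupp.mem_support_iff.1 (Finset.max'_mem _ hne), fun i hi => ?_⟩
  by_contra h
  exact hi.not_ge (Finset.le_max' _ _ (Finsupp.mem_support_iff.2 h))

theorem eq_zero_of_x_pow_mul (hO : IsOreExtension ι x τ δ) {n : ℕ} {s : S} (hs : x ^ n * s = 0) :
    s = 0 := by
  induction n with
  | zero => simpa using hs
  | succ n ih =>
    apply ih
    rw [pow_succ', mul_assoc] at hs
    by_contra h0
    obtain ⟨m, hm, hm'⟩ := hO.exists_top_coeff h0
    have h1 := hO.coeff_x_mul (x ^ n * s) m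
    rw [hs, hm' (m + 1) m.lt_succ_self] at h1
    exact hm (by simpa using h1.symm)

end IsOreExtension

/-! ### The localization L and the action of H on it -/

namespace IsCauchonExtension

variable {k R S H : Type*} [Field k] [Ring R] [Algebra k R] [Ring S] [Algebra k S] [CommGroup H]
  {ι : R →ₐ[k] S} {x : S} {τ : R ≃ₐ[k] R} {δ : R →ₗ[k] R} {q : kˣ}
  {ρR : H →* (R ≃ₐ[k] R)} {ρS : H →* (S ≃ₐ[k] S)}

theorem toL_injective (hS : IsCauchonExtension ι x τ δ q ρR ρS) :
    Function.Injective hS.toL := by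
  let := hS.isOreExtension.oreSet hS.locNilpotent
  refine OreLocalization.numeratorHom_inj ?_
  rintro _ ⟨n, rfl⟩ s hs
  exact hS.isOreExtension.eq_zero_of_x_pow_mul hs

theorem exists_x_pow_mul_eq_toL (hS : IsCauchonExtension ι x τ δ q ρR ρS) (l : hS.L) :
    ∃ (n : ℕ) (s : S), hS.toL x ^ n * l = hS.toL s := by
  let := hS.isOreExtension.oreSet hS.locNilpotent
  revert l
  refine OreLocalization.ind fun s y => ?_
  obtain ⟨_, n, rfl⟩ := y
  refine ⟨n, s, ?_⟩
  rw [← map_pow]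
  exact OreLocalization.mul_cancel (r := s) (s := (⟨x ^ n, n, rfl⟩ : Submonoid.powers x)) (t := 1)

theorem toL_smul (hS : IsCauchonExtension ι x τ δ q ρR ρS) (c : k) (s : S) :
    hS.toL (c • s) = c • hS.toL s := by
  have h : ∀ c : k, hS.toL (algebraMap k S c) = algebraMap k hS.L c := fun c => rfl
  rw [Algebra.smul_def, map_mul, h, ← Algebra.smul_def]

theorem exists_action_lift (hS : IsCauchonExtension ι x τ δ q ρR ρS) (h : H) :
    ∃ φ : hS.L →+* hS.L, ∀ s, φ (hS.toL s) = hS.toL (ρS h s) := by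
  let := hS.isOreExtension.oreSet hS.locNilpotent
  obtain ⟨c, hc⟩ := hS.exists_unit_eigenvalue h
  let f : S →+* hS.L := hS.toL.comp (ρS h : S →+* S)
  have hu : ∀ y : Submonoid.powers x, IsUnit (((f : S →* hS.L).comp (Submonoid.powers x).subtype) y)
      := by
    rintro ⟨_, n, rfl⟩
    change IsUnit (hS.toL (ρS h (x ^ n)))
    rw [map_pow, hc, smul_pow, toL_smul, Algebra.smul_def, map_pow, map_pow, ← coe_xUnit]
    exact (((c.isUnit.map (algebraMap k hS.L)).pow n)).mul (hS.xUnit.isUnit.pow n)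
  let g : Submonoid.powers x →* hS.Lˣ := IsUnit.liftRight _ hu
  have hfg : ∀ y : Submonoid.powers x, f y = g y := fun y => (IsUnit.coe_liftRight _ hu y).symm
  exact ⟨OreLocalization.universalHom f g hfg, fun s =>
    OreLocalization.universalHom_commutes f g hfg⟩

/-- The action of `H` on `L`. -/
noncomputable def actionL (hS : IsCauchonExtension ι x τ δ q ρR ρS) (h : H) : hS.L →+* hS.L :=
  (hS.exists_action_lift h).choose

theorem actionL_toL (hS : IsCauchonExtension ι x τ δ q ρR ρS) (h : H) (s : S) :
    hS.actionL h (hS.toL s) = hS.toL (ρS h s) := (hS.exists_action_lift h).choose_spec s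

theorem actionL_smul (hS : IsCauchonExtension ι x τ δ q ρR ρS) (h : H) (c : k) (l : hS.L) :
    hS.actionL h (c • l) = c • hS.actionL h l := by
  have h1 : ∀ l : hS.L, c • l = hS.toL (c • 1) * l := fun l => by simp [toL_smul]
  rw [h1, map_mul, actionL_toL, map_smul, map_one, ← h1]

/-- The powers `xⁱ` in `L`, for integers `i`. -/
noncomputable def xz (hS : IsCauchonExtension ι x τ δ q ρR ρS) (i : ℤ) : hS.L :=
  ((hS.xUnit ^ i : hS.Lˣ) : hS.L)

theorem xz_add (hS : IsCauchonExtension ι x τ δ q ρR ρS) (i j : ℤ) :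
    hS.xz (i + j) = hS.xz i * hS.xz j := by simp [xz, zpow_add]

theorem xz_zero (hS : IsCauchonExtension ι x τ δ q ρR ρS) : hS.xz 0 = 1 := by simp [xz]

theorem xz_natCast (hS : IsCauchonExtension ι x τ δ q ρR ρS) (n : ℕ) :
    hS.xz n = hS.toL x ^ n := by simp [xz, coe_xUnit]

theorem xz_one (hS : IsCauchonExtension ι x τ δ q ρR ρS) : hS.xz 1 = hS.toL x := by
  simpa using hS.xz_natCast 1

theorem xz_neg_mul_xz (hS : IsCauchonExtension ι x τ δ q ρR ρS) (i : ℤ) :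
    hS.xz (-i) * hS.xz i = 1 := by rw [← xz_add, neg_add_cancel, xz_zero]

theorem xz_mul_xz_neg (hS : IsCauchonExtension ι x τ δ q ρR ρS) (i : ℤ) :
    hS.xz i * hS.xz (-i) = 1 := by rw [← xz_add, add_neg_cancel, xz_zero]

theorem actionL_xz (hS : IsCauchonExtension ι x τ δ q ρR ρS) {h : H} {c : kˣ}
    (hc : ρS h x = (c : k) • x) (i : ℤ) : hS.actionL h (hS.xz i) = ((c ^ i : kˣ) : k) • hS.xz i := by
  have h1 : Units.map (hS.actionL h : hS.L →* hS.L) hS.xUnit =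
      Units.map (algebraMap k hS.L : k →* hS.L) c * hS.xUnit := by
    ext
    simp only [Units.coe_map, Units.val_mul, MonoidHom.coe_coe, coe_xUnit, actionL_toL, hc,
      toL_smul]
    rw [Algebra.smul_def]
  have h2 : Commute (Units.map (algebraMap k hS.L : k →* hS.L) c) hS.xUnit :=
    Units.ext (Algebra.commutes _ _)
  have h3 := congrArg Units.val (congrArg (· ^ i) h1)
  rw [h2.mul_zpow, ← map_zpow, ← map_zpow] at h3
  rw [Algebra.smul_def]
  exact h3

theorem exists_eq_xz_mul_toL (hS : IsCauchonExtension ι x τ δ q ρR ρS) (l : hS.L) :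
    ∃ (n : ℕ) (s : S), l = hS.xz (-n) * hS.toL s := by
  obtain ⟨n, s, h⟩ := hS.exists_x_pow_mul_eq_toL l
  refine ⟨n, s, ?_⟩
  rw [← h, ← xz_natCast, ← mul_assoc, xz_neg_mul_xz, one_mul]

theorem xz_one_mul_map (hS : IsCauchonExtension ι x τ δ q ρR ρS) (r : R) :
    hS.xz 1 * hS.toL (ι r) = hS.toL (ι (τ r)) * hS.xz 1 + hS.toL (ι (δ r)) := by
  rw [xz_one, ← map_mul, hS.isOreExtension.comm, map_add, map_mul]

theorem xz_neg_one_mul_map (hS : IsCauchonExtension ι x τ δ q ρR ρS) (r : R) :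
    hS.xz (-1) * hS.toL (ι r) = hS.toL (ι (τ.symm r)) * hS.xz (-1) -
      hS.xz (-1) * hS.toL (ι (δ (τ.symm r))) * hS.xz (-1) := by
  have h1 := hS.xz_one_mul_map (τ.symm r)
  rw [AlgEquiv.apply_symm_apply] at h1
  calc _ = hS.xz (-1) * (hS.toL (ι r) * hS.xz 1) * hS.xz (-1) := by
        rw [mul_assoc, mul_assoc, xz_mul_xz_neg, mul_one]
    _ = hS.xz (-1) * (hS.xz 1 * hS.toL (ι (τ.symm r)) - hS.toL (ι (δ (τ.symm r)))) * hS.xz (-1) := by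
        rw [h1, add_sub_cancel_right]
    _ = _ := by rw [mul_sub, ← mul_assoc, xz_neg_mul_xz, one_mul, sub_mul]

end IsCauchonExtension

/-! ### The scalars q_l and the degree filtration of L -/

theorem cauchonScalar_zero {k : Type*} [Field k] (q : k) : cauchonScalar q 0 = 1 := by
  simp [cauchonScalar, qFactorial_zero]

/-- This recursion is all that is used about the scalars beyond q₀ = 1; it makes the sum for x C(r)
- C(τ(r)) x telescope. -/
theorem NotRootOfUnity.cauchonScalar_succ {k : Type*} [Field k] {q : k} (hq : NotRootOfUnity q)
    (l : ℕ) : cauchonScalar q (l + 1) * (q ^ (l + 1) - 1) = cauchonScalar q l * q ^ (l + 1) := by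
  have h1 : (l + 1) * (l + 1 + 1) / 2 = l * (l + 1) / 2 + (l + 1) := by
    rw [show (l + 1) * (l + 1 + 1) = l * (l + 1) + (l + 1) * 2 by ring,
      Nat.add_mul_div_right _ _ two_pos]
  have h2 : q ^ (l + 1) - 1 = (q - 1) * qNumber q (l + 1) := (mul_geom_sum q (l + 1)).symm
  have h3 := hq.sub_one_ne_zero
  have h4 := hq.qNumber_ne_zero l
  have h5 := hq.qFactorial_ne_zero l
  rw [h2, cauchonScalar, cauchonScalar, qFactorial_succ, h1]
  field_simp
  ring

namespace IsCauchonExtension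

variable {k R S H : Type*} [Field k] [Ring R] [Algebra k R] [Ring S] [Algebra k S] [CommGroup H]
  {ι : R →ₐ[k] S} {x : S} {τ : R ≃ₐ[k] R} {δ : R →ₗ[k] R} {q : kˣ}
  {ρR : H →* (R ≃ₐ[k] R)} {ρS : H →* (S ≃ₐ[k] S)}

theorem delta_pow_tau_symm_eq_zero (hS : IsCauchonExtension ι x τ δ q ρR ρS) {n : ℕ} {r : R}
    (hr : (δ ^ n) r = 0) : (δ ^ n) (τ.symm r) = 0 := by
  have h1 := hS.delta_pow_tau n (τ.symm r)
  rwa [AlgEquiv.apply_symm_apply, hr, eq_comm, smul_eq_zero_iff_right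
    (pow_ne_zero _ q.ne_zero), map_eq_zero_iff _ τ.injective] at h1

theorem delta_pow_tau_symm_pow_eq_zero (hS : IsCauchonExtension ι x τ δ q ρR ρS) {n l : ℕ} {r : R}
    (hr : (δ ^ n) r = 0) (hl : n ≤ l) (m : ℕ) : (δ ^ l) ((τ.symm ^ m) r) = 0 := by
  induction m with
  | zero =>
    rw [← Nat.sub_add_cancel hl, pow_add, Module.End.mul_apply, pow_zero, AlgEquiv.one_apply, hr,
      map_zero]
  | succ m ih => rw [pow_succ', AlgEquiv.mul_apply]; exact hS.delta_pow_tau_symm_eq_zero ih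

/-- The span of all `r xⁱ` with `i ≤ n`. -/
noncomputable def lower (hS : IsCauchonExtension ι x τ δ q ρR ρS) (n : ℤ) : AddSubgroup hS.L :=
  AddSubgroup.closure {l | ∃ (r : R) (i : ℤ), i ≤ n ∧ l = hS.toL (ι r) * hS.xz i}

theorem mul_xz_mem_lower (hS : IsCauchonExtension ι x τ δ q ρR ρS) (r : R) {i n : ℤ} (h : i ≤ n) :
    hS.toL (ι r) * hS.xz i ∈ hS.lower n := AddSubgroup.subset_closure ⟨r, i, h, rfl⟩

theorem map_mem_lower (hS : IsCauchonExtension ι x τ δ q ρR ρS) (r : R) :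
    hS.toL (ι r) ∈ hS.lower 0 := by
  simpa [xz_zero] using hS.mul_xz_mem_lower r (le_refl 0)

theorem lower_mono (hS : IsCauchonExtension ι x τ δ q ρR ρS) : Monotone hS.lower :=
  fun _ _ h => AddSubgroup.closure_mono fun _ ⟨r, i, hi, hl⟩ => ⟨r, i, hi.trans h, hl⟩

/-- An additive map that sends all `r xⁱ` with `i ≤ n` to `A` sends `lower n` to `A`. -/
theorem map_mem_of_mem_lower (hS : IsCauchonExtension ι x τ δ q ρR ρS) {n : ℤ} (f : hS.L →+ hS.L)
    (A : AddSubgroup hS.L) (h : ∀ r, ∀ i ≤ n, f (hS.toL (ι r) * hS.xz i) ∈ A) {l : hS.L}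
    (hl : l ∈ hS.lower n) : f l ∈ A := by
  have : hS.lower n ≤ A.comap f := by
    rw [lower, AddSubgroup.closure_le]
    rintro _ ⟨r, i, hi, rfl⟩
    exact h r i hi
  exact this hl

theorem mul_xz_mem_lower_add (hS : IsCauchonExtension ι x τ δ q ρR ρS) {n : ℤ} {l : hS.L}
    (hl : l ∈ hS.lower n) (m : ℤ) : l * hS.xz m ∈ hS.lower (n + m) := by
  refine hS.map_mem_of_mem_lower (AddMonoidHom.mulRight (hS.xz m)) _ (fun r i hi => ?_) hl
  change hS.toL (ι r) * hS.xz i * hS.xz m ∈ _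
  rw [mul_assoc, ← xz_add]
  exact hS.mul_xz_mem_lower r (by lia)

theorem map_mul_mem_lower (hS : IsCauchonExtension ι x τ δ q ρR ρS) {n : ℤ} {l : hS.L}
    (hl : l ∈ hS.lower n) (r : R) : hS.toL (ι r) * l ∈ hS.lower n := by
  refine hS.map_mem_of_mem_lower (AddMonoidHom.mulLeft (hS.toL (ι r))) _ (fun a i hi => ?_) hl
  change hS.toL (ι r) * (hS.toL (ι a) * hS.xz i) ∈ _
  rw [← mul_assoc, ← map_mul, ← map_mul]
  exact hS.mul_xz_mem_lower _ hi

theorem smul_mem_lower (hS : IsCauchonExtension ι x τ δ q ρR ρS) {n : ℤ} {l : hS.L}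
    (hl : l ∈ hS.lower n) (c : k) : c • l ∈ hS.lower n := by
  have := hS.map_mul_mem_lower hl (c • 1)
  rwa [map_smul, map_one, toL_smul, map_one, smul_one_mul] at this

theorem xz_neg_one_mul_mem_lower (hS : IsCauchonExtension ι x τ δ q ρR ρS) {n : ℤ} {l : hS.L}
    (hl : l ∈ hS.lower n) : hS.xz (-1) * l ∈ hS.lower (n - 1) := by
  have key : ∀ (N : ℕ) (r : R), (δ ^ N) r = 0 → hS.xz (-1) * hS.toL (ι r) ∈ hS.lower (-1) := by
    intro N
    induction N with
    | zero => intro r hr; rw [pow_zero, Module.End.one_apply] at hr; simp [hr, zero_mem]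
    | succ N ih =>
      intro r hr
      rw [xz_neg_one_mul_map]
      have h1 := ih (δ (τ.symm r)) (by
        simpa [pow_succ] using hS.delta_pow_tau_symm_eq_zero hr)
      exact sub_mem (hS.mul_xz_mem_lower _ le_rfl)
        (hS.lower_mono (by lia) (hS.mul_xz_mem_lower_add h1 (-1)))
  refine hS.map_mem_of_mem_lower (AddMonoidHom.mulLeft (hS.xz (-1))) _ (fun r i hi => ?_) hl
  change hS.xz (-1) * (hS.toL (ι r) * hS.xz i) ∈ _
  obtain ⟨N, hN⟩ := hS.locNilpotent r
  rw [← mul_assoc]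
  exact hS.lower_mono (by lia) (hS.mul_xz_mem_lower_add (key N r hN) i)

theorem xz_neg_mul_mem_lower (hS : IsCauchonExtension ι x τ δ q ρR ρS) {n : ℤ} {l : hS.L}
    (hl : l ∈ hS.lower n) (m : ℕ) : hS.xz (-m) * l ∈ hS.lower (n - m) := by
  induction m with
  | zero => simpa [xz_zero]
  | succ m ih =>
    have := hS.xz_neg_one_mul_mem_lower ih
    rw [← mul_assoc, ← xz_add] at this
    rwa [show -1 + -(m : ℤ) = -((m + 1 : ℕ) : ℤ) by push_cast; ring,
      show n - m - 1 = n - ((m + 1 : ℕ) : ℤ) by push_cast; ring] at this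

theorem mul_mem_lower (hS : IsCauchonExtension ι x τ δ q ρR ρS) {m n : ℤ} (hm : m ≤ 0) {l l' : hS.L}
    (hl : l ∈ hS.lower m) (hl' : l' ∈ hS.lower n) : l * l' ∈ hS.lower (m + n) := by
  refine hS.map_mem_of_mem_lower (AddMonoidHom.mulRight l') _ (fun r i hi => ?_) hl
  change hS.toL (ι r) * hS.xz i * l' ∈ _
  obtain ⟨j, hj⟩ := Int.eq_ofNat_of_zero_le (show 0 ≤ -i by lia)
  obtain rfl : i = -j := by lia
  rw [mul_assoc]
  exact hS.lower_mono (by lia) (hS.map_mul_mem_lower (hS.xz_neg_mul_mem_lower hl' j) r)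

/-- Clearing denominators on the right: negative degree in L becomes the condition that `l * x ^ N`
is a polynomial of degree below `N`, where coefficients are unique. -/
theorem exists_mul_xz_eq_toL (hS : IsCauchonExtension ι x τ δ q ρR ρS) {l : hS.L}
    (hl : l ∈ hS.lower (-1)) : ∃ (N : ℕ) (s : S), l * hS.xz N = hS.toL s ∧
      ∀ i, N ≤ i → hS.isOreExtension.coeff s i = 0 := by
  have hmono : ∀ (N M : ℕ) (l : hS.L) (s : S), l * hS.xz N = hS.toL s →
      (∀ i, N ≤ i → hS.isOreExtension.coeff s i = 0) → ∃ s', l * hS.xz ((N + M : ℕ) : ℤ) = hS.toL s' ∧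
        ∀ i, N + M ≤ i → hS.isOreExtension.coeff s' i = 0 := by
    intro N M l s h h'
    induction M with
    | zero => exact ⟨s, h, h'⟩
    | succ M ih =>
      obtain ⟨s', h1, h2⟩ := ih
      refine ⟨s' * x, ?_, fun i hi => ?_⟩
      · rw [map_mul, ← h1, mul_assoc, ← xz_one, ← xz_add]
        push_cast
        ring_nf
      · obtain ⟨i, rfl⟩ := Nat.exists_eq_succ_of_ne_zero (show i ≠ 0 by lia)
        rw [Nat.succ_eq_add_one, hS.isOreExtension.coeff_mul_x_succ]
        exact h2 i (by lia)
  refine AddSubgroup.closure_induction ?_ ⟨0, 0, by simp, by simp⟩ ?_ ?_ hl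
  · rintro _ ⟨r, i, hi, rfl⟩
    obtain ⟨j, hj⟩ := Int.eq_ofNat_of_zero_le (show 0 ≤ -i by lia)
    obtain rfl : i = -j := by lia
    refine ⟨j, ι r, by rw [mul_assoc, xz_neg_mul_xz, mul_one], fun m hm => ?_⟩
    rw [hS.isOreExtension.coeff_map, Finsupp.single_eq_of_ne (by lia)]
  · rintro l l' - - ⟨N, s, h1, h2⟩ ⟨M, t, h3, h4⟩
    obtain ⟨s', h5, h6⟩ := hmono N M l s h1 h2
    obtain ⟨t', h7, h8⟩ := hmono M N l' t h3 h4
    rw [add_comm M N] at h7 h8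
    refine ⟨N + M, s' + t', by rw [add_mul, h5, h7, map_add], fun i hi => ?_⟩
    rw [map_add, Finsupp.add_apply, h6 i hi, h8 i hi, add_zero]
  · rintro l - ⟨N, s, h1, h2⟩
    exact ⟨N, -s, by rw [neg_mul, h1, map_neg], fun i hi => by
      rw [map_neg, Finsupp.neg_apply, h2 i hi, neg_zero]⟩

theorem coeff_action (hS : IsCauchonExtension ι x τ δ q ρR ρS) {h : H} {c : kˣ}
    (hc : ρS h x = (c : k) • x) (s : S) (m : ℕ) :
    hS.isOreExtension.coeff (ρS h s) m = (c : k) ^ m • ρR h (hS.isOreExtension.coeff s m) := by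
  refine hS.isOreExtension.addMonoidHom_ext
    (f := ((Finsupp.applyAddHom m).comp hS.isOreExtension.coeff.toAddMonoidHom).comp
      (ρS h : S →+ S))
    (g := ((DistribSMul.toAddMonoidHom R ((c : k) ^ m)).comp (ρR h : R →+ R)).comp
      ((Finsupp.applyAddHom m).comp hS.isOreExtension.coeff.toAddMonoidHom)) (fun r i => ?_) s
  change hS.isOreExtension.coeff (ρS h (ι r * x ^ i)) m =
    (c : k) ^ m • ρR h (hS.isOreExtension.coeff (ι r * x ^ i) m)
  rw [map_mul, map_pow, hc, hS.action_restrict, smul_pow, mul_smul_comm, ← smul_mul_assoc,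
    ← map_smul, IsOreExtension.coeff_mul_pow, IsOreExtension.coeff_mul_pow]
  rcases eq_or_ne i m with rfl | hne
  · simp
  · simp [Finsupp.single_eq_of_ne hne.symm]

end IsCauchonExtension

namespace IsOreExtension

variable {k R S : Type*} [Field k] [Ring R] [Algebra k R] [Ring S] [Algebra k S]
  {ι : R →ₐ[k] S} {x : S} {τ : R ≃ₐ[k] R} {δ : R →ₗ[k] R}

theorem coeff_smul (hO : IsOreExtension ι x τ δ) (c : k) (s : S) (m : ℕ) :
    hO.coeff (c • s) m = c • hO.coeff s m := by
  refine hO.addMonoidHom_ext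
    (f := ((Finsupp.applyAddHom m).comp hO.coeff.toAddMonoidHom).comp
      (DistribSMul.toAddMonoidHom S c))
    (g := (DistribSMul.toAddMonoidHom R c).comp
      ((Finsupp.applyAddHom m).comp hO.coeff.toAddMonoidHom)) (fun r i => ?_) s
  change hO.coeff (c • (ι r * x ^ i)) m = c • hO.coeff (ι r * x ^ i) m
  rw [← smul_mul_assoc, ← map_smul, coeff_mul_pow, coeff_mul_pow, ← Finsupp.smul_single,
    Finsupp.smul_apply]

end IsOreExtension

/-! ### The deleting-derivation map is an injective homomorphism -/

namespace IsCauchonExtension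

variable {k R S H : Type*} [Field k] [Ring R] [Algebra k R] [Ring S] [Algebra k S] [CommGroup H]
  {ι : R →ₐ[k] S} {x : S} {τ : R ≃ₐ[k] R} {δ : R →ₗ[k] R} {q : kˣ}
  {ρR : H →* (R ≃ₐ[k] R)} {ρS : H →* (S ≃ₐ[k] S)}

attribute [local irreducible] IsCauchonExtension.instRingL

theorem C_eq_sum (hS : IsCauchonExtension ι x τ δ q ρR ρS) {N : ℕ} {r : R} (hr : (δ ^ N) r = 0) :
    hS.C r = ∑ l ∈ Finset.range N, cauchonScalar (q : k) l •
      (hS.toL (ι ((δ ^ l) ((τ.symm ^ l) r))) * hS.xz (-l)) := by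
  have h : ∀ l : ℕ, ((hS.xUnit⁻¹ ^ l : hS.Lˣ) : hS.L) = hS.xz (-l) := fun l => by simp [xz]
  simp only [C, h]
  refine finsum_eq_sum_of_support_subset _ fun l hl => ?_
  by_contra hc
  refine hl ?_
  dsimp only
  rw [hS.delta_pow_tau_symm_pow_eq_zero hr (by simpa using hc)]
  simp

theorem exists_delta_pow_eq_zero₂ (hS : IsCauchonExtension ι x τ δ q ρR ρS) (r s : R) :
    ∃ N, (δ ^ N) r = 0 ∧ (δ ^ N) s = 0 := by
  obtain ⟨m, hm⟩ := hS.locNilpotent r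
  obtain ⟨n, hn⟩ := hS.locNilpotent s
  refine ⟨m + n, ?_, ?_⟩
  · rw [add_comm, pow_add, Module.End.mul_apply, hm, map_zero]
  · rw [pow_add, Module.End.mul_apply, hn, map_zero]

theorem C_add (hS : IsCauchonExtension ι x τ δ q ρR ρS) (r s : R) :
    hS.C (r + s) = hS.C r + hS.C s := by
  obtain ⟨N, hr, hs⟩ := hS.exists_delta_pow_eq_zero₂ r s
  rw [hS.C_eq_sum hr, hS.C_eq_sum hs, hS.C_eq_sum (N := N) (by rw [map_add, hr, hs, add_zero]),
    ← Finset.sum_add_distrib]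
  simp only [map_add, add_mul, smul_add]

/-- The deleting-derivation map as an additive map. -/
noncomputable def CHom (hS : IsCauchonExtension ι x τ δ q ρR ρS) : R →+ hS.L :=
  AddMonoidHom.mk' hS.C hS.C_add

theorem C_zero (hS : IsCauchonExtension ι x τ δ q ρR ρS) : hS.C 0 = 0 := map_zero hS.CHom

theorem delta_one (hS : IsCauchonExtension ι x τ δ q ρR ρS) : δ 1 = 0 := by
  simpa using hS.isOreExtension.leibniz 1 1

theorem C_one (hS : IsCauchonExtension ι x τ δ q ρR ρS) : hS.C 1 = 1 := by
  rw [hS.C_eq_sum (N := 1) (by simpa using hS.delta_one)]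
  simp [cauchonScalar_zero, xz_zero]

theorem C_sub_mem_lower (hS : IsCauchonExtension ι x τ δ q ρR ρS) (r : R) :
    hS.C r - hS.toL (ι r) ∈ hS.lower (-1) := by
  obtain ⟨N, hN⟩ := hS.locNilpotent r
  rw [hS.C_eq_sum (N := N + 1) (by rw [pow_succ', Module.End.mul_apply, hN, map_zero]),
    Finset.sum_range_succ']
  simp only [cauchonScalar_zero, pow_zero, Module.End.one_apply, AlgEquiv.one_apply,
    Nat.cast_zero, neg_zero, xz_zero, mul_one, one_smul, add_sub_cancel_right]
  exact sum_mem fun l _ => hS.smul_mem_lower (hS.mul_xz_mem_lower _ (by push_cast; lia)) _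

theorem C_mem_lower (hS : IsCauchonExtension ι x τ δ q ρR ρS) (r : R) : hS.C r ∈ hS.lower 0 := by
  rw [← sub_add_cancel (hS.C r) (hS.toL (ι r))]
  exact add_mem (hS.lower_mono (by lia) (hS.C_sub_mem_lower r)) (hS.map_mem_lower r)

/-- With a_l = δ^l τ^(-l)(r), the l-th terms of the two sides differ by a multiple of τ(a_l) x^(1-l)
and one of δ(a_l) x^(-l). As δ(a_l) = q^(l+1) τ(a_(l+1)), the difference telescopes. -/
theorem xz_one_mul_C (hS : IsCauchonExtension ι x τ δ q ρR ρS) (r : R) :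
    hS.xz 1 * hS.C r = hS.C (τ r) * hS.xz 1 := by
  obtain ⟨N, hN⟩ := hS.locNilpotent r
  have hN' : (δ ^ N) (τ r) = 0 := by rw [hS.delta_pow_tau, hN, map_zero, smul_zero]
  rw [hS.C_eq_sum hN, hS.C_eq_sum hN', Finset.mul_sum, Finset.sum_mul, ← sub_eq_zero,
    ← Finset.sum_sub_distrib]
  let w : ℕ → hS.L := fun l => (cauchonScalar (q : k) l * ((q : k) ^ l - 1)) •
    (hS.toL (ι (τ ((δ ^ l) ((τ.symm ^ l) r)))) * hS.xz (1 - l))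
  have hw : ∀ l ∈ Finset.range N,
      hS.xz 1 * cauchonScalar (q : k) l •
          (hS.toL (ι ((δ ^ l) ((τ.symm ^ l) r))) * hS.xz (-l)) -
        cauchonScalar (q : k) l •
          (hS.toL (ι ((δ ^ l) ((τ.symm ^ l) (τ r)))) * hS.xz (-l)) * hS.xz 1 =
      w (l + 1) - w l := by
    intro l _
    have e1 : (δ ^ l) ((τ.symm ^ l) (τ r)) = (q : k) ^ l • τ ((δ ^ l) ((τ.symm ^ l) r)) := by
      rw [← hS.delta_pow_tau]
      congr 1
      exact DFunLike.congr_fun ((Commute.inv_left (Commute.refl τ)).pow_left l).eq r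
    have e2 : δ ((δ ^ l) ((τ.symm ^ l) r)) =
        (q : k) ^ (l + 1) • τ ((δ ^ (l + 1)) ((τ.symm ^ (l + 1)) r)) := by
      rw [← hS.delta_pow_tau, pow_succ' τ.symm, AlgEquiv.mul_apply, AlgEquiv.apply_symm_apply,
        pow_succ', Module.End.mul_apply]
    rw [mul_smul_comm, ← mul_assoc, xz_one_mul_map, e1, e2, add_mul, mul_assoc, ← xz_add,
      smul_mul_assoc, mul_assoc _ (hS.xz (-l)), ← xz_add, map_smul ι, map_smul ι, toL_smul, toL_smul]
    simp only [w, hS.q_notRootOfUnity.cauchonScalar_succ]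
    rw [show (1 : ℤ) - ((l + 1 : ℕ) : ℤ) = -l by push_cast; ring, show (1 : ℤ) - l = 1 + -l by ring,
      show -(l : ℤ) + 1 = 1 + -l by ring]
    simp only [smul_mul_assoc]
    module
  rw [Finset.sum_congr rfl hw, Finset.sum_range_sub]
  -- Both ends vanish: at `N` by local nilpotence, at 0 because of the factor q⁰ - 1.
  have hwN : w N = 0 := by
    dsimp only [w]
    rw [hS.delta_pow_tau_symm_pow_eq_zero hN le_rfl, map_zero, map_zero, map_zero, zero_mul,
      smul_zero]
  have hw0 : w 0 = 0 := by simp [w]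
  rw [hwN, hw0, sub_zero]

/-- The factor c^l produced by δ^l cancels the factor c^(-l) produced by x^(-l). -/
theorem actionL_C (hS : IsCauchonExtension ι x τ δ q ρR ρS) (h : H) (r : R) :
    hS.actionL h (hS.C r) = hS.C (ρR h r) := by
  obtain ⟨c, hc⟩ := hS.exists_unit_eigenvalue h
  obtain ⟨N, hN⟩ := hS.locNilpotent r
  have hN' : (δ ^ N) (ρR h r) = 0 := by
    have := hS.action_delta_pow hc N r
    rwa [hN, map_zero, eq_comm, smul_eq_zero_iff_right (pow_ne_zero _ c.ne_zero)] at this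
  rw [hS.C_eq_sum hN, hS.C_eq_sum hN', map_sum]
  refine Finset.sum_congr rfl fun l _ => ?_
  have h1 : ∀ m, ρR h ((τ.symm ^ m) r) = (τ.symm ^ m) (ρR h r) := by
    intro m
    induction m with
    | zero => simp
    | succ m ih => rw [pow_succ', AlgEquiv.mul_apply, hS.action_tau_symm, ih, AlgEquiv.mul_apply]
  rw [actionL_smul, map_mul, actionL_toL, hS.actionL_xz hc, hS.action_restrict,
    hS.action_delta_pow hc, h1, map_smul, toL_smul, smul_mul_assoc, mul_smul_comm, smul_smul,
    smul_smul, zpow_neg, zpow_natCast, ← Units.val_pow_eq_pow_val, mul_assoc, Units.mul_inv, mul_one]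

/-- `l ↦ x⁻¹ h₀(l) x`, which fixes `C(R)` and rescales `x`. -/
noncomputable def twist (hS : IsCauchonExtension ι x τ δ q ρR ρS) (h : H) : hS.L →+ hS.L :=
  ((AddMonoidHom.mulLeft (hS.xz (-1))).comp (AddMonoidHom.mulRight (hS.xz 1))).comp
    (hS.actionL h : hS.L →+ hS.L)

theorem twist_apply (hS : IsCauchonExtension ι x τ δ q ρR ρS) (h : H) (l : hS.L) :
    hS.twist h l = hS.xz (-1) * (hS.actionL h l * hS.xz 1) := rfl

theorem twist_mul (hS : IsCauchonExtension ι x τ δ q ρR ρS) (h : H) (l l' : hS.L) :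
    hS.twist h (l * l') = hS.twist h l * hS.twist h l' := by
  simp only [twist_apply, map_mul, mul_assoc]
  rw [← mul_assoc (hS.xz 1), xz_mul_xz_neg, one_mul]

theorem twist_C (hS : IsCauchonExtension ι x τ δ q ρR ρS) {h : H} (hh : ∀ r, ρR h r = τ r) (r : R) :
    hS.twist h (hS.C r) = hS.C r := by
  rw [twist_apply, actionL_C, hh, ← xz_one_mul_C, ← mul_assoc, xz_neg_mul_xz, one_mul]

theorem twist_smul (hS : IsCauchonExtension ι x τ δ q ρR ρS) (h : H) (c : k) (l : hS.L) :
    hS.twist h (c • l) = c • hS.twist h l := by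
  rw [twist_apply, twist_apply, actionL_smul, smul_mul_assoc, mul_smul_comm]

theorem twist_xz (hS : IsCauchonExtension ι x τ δ q ρR ρS) {h : H} {c : kˣ}
    (hc : ρS h x = (c : k) • x) (i : ℤ) :
    hS.twist h (hS.xz i) = ((c ^ i : kˣ) : k) • hS.xz i := by
  rw [twist_apply, hS.actionL_xz hc, smul_mul_assoc, mul_smul_comm, ← xz_add, ← xz_add]
  ring_nf

/-- `0` is the only element of negative degree fixed by the twist. -/
theorem eq_zero_of_twist_eq (hS : IsCauchonExtension ι x τ δ q ρR ρS) {h : H}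
    (hh : ∀ r, ρR h r = τ r) {c : kˣ} (hc : ρS h x = (c : k) • x) (hc' : NotRootOfUnity (c : k))
    {l : hS.L} (hl : l ∈ hS.lower (-1)) (hfix : hS.twist h l = l) : l = 0 := by
  obtain ⟨N, s, hs, hcoeff⟩ := hS.exists_mul_xz_eq_toL hl
  have h1 : hS.actionL h l * hS.xz 1 = hS.xz 1 * l := by
    conv_rhs => rw [← hfix, twist_apply, ← mul_assoc, xz_mul_xz_neg, one_mul]
  have h2 : hS.toL (ρS h s * x) = hS.toL ((c : k) ^ N • (x * s)) := by
    rw [toL_smul, map_mul, map_mul, ← actionL_toL, ← hs, map_mul, hS.actionL_xz hc, ← xz_one,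
      ← mul_assoc, ← h1, mul_smul_comm, smul_mul_assoc, mul_assoc, mul_assoc, ← xz_add, ← xz_add,
      add_comm, zpow_natCast, Units.val_pow_eq_pow_val]
  have h3 := hS.toL_injective h2
  have h4 : s = 0 := by
    by_contra h0
    obtain ⟨m, hm, hm'⟩ := hS.isOreExtension.exists_top_coeff h0
    have hmN : m < N := by
      by_contra hge
      exact hm (hcoeff m (not_lt.1 hge))
    -- For h(s) x = c^N x s the coefficients in degree m + 1, with m the top degree of s, give c^m
    -- τ(s_m) = c^N τ(s_m). As m < N and c is not a root of unity, s_m = 0.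
    have h5 := congrArg (fun t => hS.isOreExtension.coeff t (m + 1)) h3
    rw [hS.isOreExtension.coeff_mul_x_succ, hS.coeff_action hc,
      IsOreExtension.coeff_smul,
      hS.isOreExtension.coeff_x_mul, hm' _ m.lt_succ_self, map_zero, add_zero, hh, ← sub_eq_zero,
      ← sub_smul, smul_eq_zero] at h5
    rcases h5 with h5 | h5
    · refine hc' (N - m) (by lia) ?_
      rw [sub_eq_zero] at h5
      apply mul_left_cancel₀ (pow_ne_zero m c.ne_zero)
      rw [← pow_add, Nat.add_sub_cancel' hmN.le, ← h5, mul_one]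
    · exact hm (by simpa using h5)
  rw [h4, map_zero] at hs
  rw [← mul_one l, ← xz_mul_xz_neg hS N, ← mul_assoc, hs, zero_mul]

/-- If the eigenvalue of h₀ is 0, then x = 0 and S is trivial, so `q` can replace it. -/
theorem exists_twist (hS : IsCauchonExtension ι x τ δ q ρR ρS) : ∃ (h : H) (c : kˣ),
    (∀ r, ρR h r = τ r) ∧ ρS h x = (c : k) • x ∧ NotRootOfUnity (c : k) := by
  obtain ⟨h, hh, c, hc, hc'⟩ := hS.exists_h₀
  rcases eq_or_ne c 0 with rfl | h0
  · have := hS.isOreExtension.subsingleton_of_x_eq_zero ((ρS h).injective (by simpa using hc))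
    exact ⟨h, q, hh, Subsingleton.elim _ _, hS.q_notRootOfUnity⟩
  · exact ⟨h, Units.mk0 c h0, hh, hc, hc'⟩

/-- The defect C(r)C(s) - C(rs) has negative degree, because the terms of degree 0 cancel, and it is
fixed by the multiplicative twist. Hence it vanishes. -/
theorem C_mul (hS : IsCauchonExtension ι x τ δ q ρR ρS) (r s : R) :
    hS.C (r * s) = hS.C r * hS.C s := by
  obtain ⟨h, c, hh, hc, hc'⟩ := hS.exists_twist
  rw [eq_comm, ← sub_eq_zero]
  refine hS.eq_zero_of_twist_eq hh hc hc' ?_ ?_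
  · have h1 := hS.mul_mem_lower (by lia) (hS.C_sub_mem_lower r) (hS.C_mem_lower s)
    have h2 := hS.map_mul_mem_lower (hS.C_sub_mem_lower s) r
    have h3 := hS.C_sub_mem_lower (r * s)
    convert sub_mem (add_mem (hS.lower_mono (by lia) h1) h2) h3 using 1
    rw [map_mul, map_mul]
    noncomm_ring
  · rw [map_sub, twist_mul, hS.twist_C hh, hS.twist_C hh, hS.twist_C hh]

/-- The degree 0 term of C(r) is r; if C(r) = 0, then r itself would have negative degree. -/
theorem eq_zero_of_C_eq_zero (hS : IsCauchonExtension ι x τ δ q ρR ρS) {r : R} (hr : hS.C r = 0) :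
    r = 0 := by
  have h1 := hS.C_sub_mem_lower r
  rw [hr, zero_sub, neg_mem_iff] at h1
  obtain ⟨N, s, hs, hs'⟩ := hS.exists_mul_xz_eq_toL h1
  rw [xz_natCast, ← map_pow, ← map_mul] at hs
  have h2 := hs' N le_rfl
  rw [← hS.toL_injective hs, IsOreExtension.coeff_mul_pow] at h2
  simpa using h2

/-! ### L as a skew Laurent ring over C(R) -/

theorem xz_mul_C (hS : IsCauchonExtension ι x τ δ q ρR ρS) (i : ℤ) (r : R) :
    hS.xz i * hS.C r = hS.C ((τ ^ i) r) * hS.xz i := by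
  induction i generalizing r with
  | zero => simp [xz_zero]
  | succ i ih =>
    rw [xz_add, mul_assoc, xz_one_mul_C, ← mul_assoc, ih, zpow_add, AlgEquiv.mul_apply, zpow_one,
      mul_assoc]
  | pred i ih =>
    have h1 := hS.xz_one_mul_C (τ⁻¹ r)
    have h2 : hS.xz (-1) * hS.C r = hS.C (τ⁻¹ r) * hS.xz (-1) := by
      rw [← AlgEquiv.mul_apply, mul_inv_cancel, AlgEquiv.one_apply] at h1
      rw [← mul_one (hS.C r), ← xz_mul_xz_neg hS 1, ← mul_assoc (hS.C r), ← h1, ← mul_assoc,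
        ← mul_assoc, xz_neg_mul_xz, one_mul]
    rw [sub_eq_add_neg, xz_add, mul_assoc, h2, ← mul_assoc, ih, zpow_add, AlgEquiv.mul_apply,
      zpow_neg_one, mul_assoc]

theorem C_mul_xz_mul (hS : IsCauchonExtension ι x τ δ q ρR ρS) (r s : R) (i j : ℤ) :
    (hS.C r * hS.xz i) * (hS.C s * hS.xz j) = hS.C (r * (τ ^ i) s) * hS.xz (i + j) := by
  rw [mul_assoc, ← mul_assoc (hS.xz i), xz_mul_C, mul_assoc, ← xz_add, ← mul_assoc, C_mul]

/-- The span of all `C(r) xⁱ` with `r ∈ I`. -/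
noncomputable def laurent (hS : IsCauchonExtension ι x τ δ q ρR ρS) (I : Set R) : AddSubgroup hS.L :=
  AddSubgroup.closure {l | ∃ r ∈ I, ∃ i : ℤ, l = hS.C r * hS.xz i}

theorem C_mul_xz_mem_laurent (hS : IsCauchonExtension ι x τ δ q ρR ρS) {I : Set R} {r : R}
    (hr : r ∈ I) (i : ℤ) : hS.C r * hS.xz i ∈ hS.laurent I :=
  AddSubgroup.subset_closure ⟨r, hr, i, rfl⟩

theorem map_mem_of_mem_laurent (hS : IsCauchonExtension ι x τ δ q ρR ρS) {I : Set R}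
    (f : hS.L →+ hS.L) (A : AddSubgroup hS.L) (h : ∀ r ∈ I, ∀ i, f (hS.C r * hS.xz i) ∈ A)
    {l : hS.L} (hl : l ∈ hS.laurent I) : f l ∈ A := by
  have : hS.laurent I ≤ A.comap f := by
    rw [laurent, AddSubgroup.closure_le]
    rintro _ ⟨r, hr, i, rfl⟩
    exact h r hr i
  exact this hl

theorem xz_mul_mem_laurent_univ (hS : IsCauchonExtension ι x τ δ q ρR ρS) (i : ℤ) {l : hS.L}
    (hl : l ∈ hS.laurent Set.univ) : hS.xz i * l ∈ hS.laurent Set.univ := by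
  refine hS.map_mem_of_mem_laurent (AddMonoidHom.mulLeft (hS.xz i)) _ (fun r _ j => ?_) hl
  change hS.xz i * (hS.C r * hS.xz j) ∈ _
  rw [← mul_assoc, xz_mul_C, mul_assoc, ← xz_add]
  exact hS.C_mul_xz_mem_laurent (Set.mem_univ _) _

theorem C_mul_mem_laurent_univ (hS : IsCauchonExtension ι x τ δ q ρR ρS) (a : R) {l : hS.L}
    (hl : l ∈ hS.laurent Set.univ) : hS.C a * l ∈ hS.laurent Set.univ := by
  refine hS.map_mem_of_mem_laurent (AddMonoidHom.mulLeft (hS.C a)) _ (fun r _ j => ?_) hl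
  change hS.C a * (hS.C r * hS.xz j) ∈ _
  rw [← mul_assoc, ← C_mul]
  exact hS.C_mul_xz_mem_laurent (Set.mem_univ _) _

theorem smul_mem_laurent_univ (hS : IsCauchonExtension ι x τ δ q ρR ρS) (c : k) {l : hS.L}
    (hl : l ∈ hS.laurent Set.univ) : c • l ∈ hS.laurent Set.univ := by
  have h1 : hS.C (c • 1) = c • 1 := by
    have h2 : δ (c • 1) = 0 := by rw [map_smul, hS.delta_one, smul_zero]
    rw [hS.C_eq_sum (N := 1) (by simpa using h2)]
    simp [cauchonScalar_zero, xz_zero, toL_smul]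
  have h3 := hS.C_mul_mem_laurent_univ (c • 1) hl
  rwa [h1, smul_one_mul] at h3

/-- The definition of `C` is triangular: r is C(r) minus terms in δ^l(τ^(-l)(r)) with l ≥ 1, which
have smaller order of nilpotency. -/
theorem map_mul_mem_laurent_univ (hS : IsCauchonExtension ι x τ δ q ρR ρS) (N : ℕ) :
    ∀ r, (δ ^ N) r = 0 → ∀ l ∈ hS.laurent Set.univ, hS.toL (ι r) * l ∈ hS.laurent Set.univ := by
  induction N with
  | zero => intro r hr l _; rw [pow_zero, Module.End.one_apply] at hr; simp [hr, zero_mem]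
  | succ N ih =>
    intro r hr l hl
    have h1 := hS.C_eq_sum hr
    rw [Finset.sum_range_succ'] at h1
    simp only [cauchonScalar_zero, pow_zero, Module.End.one_apply, AlgEquiv.one_apply,
      Nat.cast_zero, neg_zero, xz_zero, mul_one, one_smul] at h1
    rw [eq_sub_of_add_eq' h1.symm, sub_mul, Finset.sum_mul]
    refine sub_mem (hS.C_mul_mem_laurent_univ r hl) (sum_mem fun i _ => ?_)
    rw [smul_mul_assoc, mul_assoc]
    refine hS.smul_mem_laurent_univ _ (ih _ ?_ _ (hS.xz_mul_mem_laurent_univ _ hl))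
    rw [← Module.End.mul_apply, ← pow_add]
    exact hS.delta_pow_tau_symm_pow_eq_zero hr (by lia) _

theorem mem_laurent_univ (hS : IsCauchonExtension ι x τ δ q ρR ρS) (l : hS.L) :
    l ∈ hS.laurent Set.univ := by
  obtain ⟨n, s, rfl⟩ := hS.exists_eq_xz_mul_toL l
  refine hS.xz_mul_mem_laurent_univ _ (hS.isOreExtension.mem_of_forall_mul_pow
    ((hS.laurent Set.univ).comap hS.toL.toAddMonoidHom) (fun r i => ?_) s)
  change hS.toL (ι r * x ^ i) ∈ hS.laurent Set.univ
  obtain ⟨N, hN⟩ := hS.locNilpotent r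
  rw [map_mul, map_pow, ← xz_natCast]
  refine hS.map_mul_mem_laurent_univ N r hN _ ?_
  simpa [C_one] using hS.C_mul_xz_mem_laurent (I := Set.univ) (r := 1) (Set.mem_univ _) i

end IsCauchonExtension

theorem NotRootOfUnity.zpow_injective {k : Type*} [Field k] {c : kˣ} (hc : NotRootOfUnity (c : k)) :
    Function.Injective fun i : ℤ => ((c ^ i : kˣ) : k) := by
  refine Units.val_injective.comp (injective_zpow_iff_not_isOfFinOrder.2 fun h => ?_)
  obtain ⟨n, hn, h1⟩ := isOfFinOrder_iff_pow_eq_one.1 h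
  exact hc n hn (by rw [← Units.val_pow_eq_pow_val, h1, Units.val_one])

/-! ### H-stable ideals of L are homogeneous -/

namespace IsCauchonExtension

variable {k R S H : Type*} [Field k] [Ring R] [Algebra k R] [Ring S] [Algebra k S] [CommGroup H]
  {ι : R →ₐ[k] S} {x : S} {τ : R ≃ₐ[k] R} {δ : R →ₗ[k] R} {q : kˣ}
  {ρR : H →* (R ≃ₐ[k] R)} {ρS : H →* (S ≃ₐ[k] S)}

attribute [local irreducible] IsCauchonExtension.instRingL

/-- An eigenvector that is congruent, modulo a stable ideal, to a sum of eigenvectors for other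
eigenvalues lies in the ideal. -/
theorem mem_of_add_sum_mem (hS : IsCauchonExtension ι x τ δ q ρR ρS) {h : H} {E : TwoSidedIdeal hS.L}
    (hE : ∀ l ∈ E, hS.twist h l ∈ E) {κ : Type*} (T : Finset κ) (μ : κ → k) (μ₀ : k) (v : κ → hS.L)
    (v₀ : hS.L) (hv₀ : hS.twist h v₀ = μ₀ • v₀) (hv : ∀ i ∈ T, hS.twist h (v i) = μ i • v i)
    (hμ : ∀ i ∈ T, μ i ≠ μ₀) (hmem : v₀ + ∑ i ∈ T, v i ∈ E) : v₀ ∈ E := by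
  classical
  induction T using Finset.induction_on generalizing v v₀ with
  | empty => simpa using hmem
  | insert a T ha ih =>
    rw [Finset.sum_insert ha] at hmem
    -- Applying the twist minus `μ a` removes `v a` and rescales the other eigenvectors, with a
    -- nonzero factor on `v₀`.
    have h1 := E.sub_mem (hE _ hmem) (E.algebra_smul_mem (μ a) hmem)
    have hne : μ₀ - μ a ≠ 0 := sub_ne_zero.2 (hμ a (Finset.mem_insert_self _ _)).symm
    rw [← E.algebra_smul_mem_iff hne]
    refine ih (fun i => (μ i - μ a) • v i) _ (by rw [twist_smul, hv₀, smul_comm])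
      (fun i hi => by rw [twist_smul, hv i (Finset.mem_insert_of_mem hi), smul_comm])
      (fun i hi => hμ i (Finset.mem_insert_of_mem hi)) ?_
    convert h1 using 1
    have h2 : ∑ i ∈ T, hS.twist h (v i) = ∑ i ∈ T, μ i • v i :=
      Finset.sum_congr rfl fun i hi => hv i (Finset.mem_insert_of_mem hi)
    rw [map_add, map_add, map_sum, hv₀, hv a (Finset.mem_insert_self _ _), h2]
    simp only [sub_smul, Finset.sum_sub_distrib, smul_add, Finset.smul_sum]
    abel

theorem twist_mem (hS : IsCauchonExtension ι x τ δ q ρR ρS) {E : TwoSidedIdeal hS.L}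
    (hE : ∀ h, ∀ l ∈ E, hS.actionL h l ∈ E) (h : H) : ∀ l ∈ E, hS.twist h l ∈ E := fun l hl => by
  rw [twist_apply]
  exact E.mul_mem_left _ _ (E.mul_mem_right _ _ (hE h l hl))

/-- The sum `∑ C(pᵢ) xⁱ`. -/
noncomputable def laurentSum (hS : IsCauchonExtension ι x τ δ q ρR ρS) : (ℤ →₀ R) →+ hS.L :=
  Finsupp.liftAddHom fun i => (AddMonoidHom.mulRight (hS.xz i)).comp hS.CHom

theorem laurentSum_apply (hS : IsCauchonExtension ι x τ δ q ρR ρS) (p : ℤ →₀ R) :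
    hS.laurentSum p = ∑ i ∈ p.support, hS.C (p i) * hS.xz i := rfl

theorem laurentSum_single (hS : IsCauchonExtension ι x τ δ q ρR ρS) (i : ℤ) (r : R) :
    hS.laurentSum (Finsupp.single i r) = hS.C r * hS.xz i :=
  Finsupp.liftAddHom_apply_single _ _ _

theorem exists_eq_laurentSum (hS : IsCauchonExtension ι x τ δ q ρR ρS) {I : AddSubgroup R} {l : hS.L}
    (hl : l ∈ hS.laurent I) : ∃ p : ℤ →₀ R, (∀ i, p i ∈ I) ∧ hS.laurentSum p = l := by
  refine AddSubgroup.closure_induction ?_ ⟨0, fun _ => I.zero_mem, map_zero _⟩ ?_ ?_ hl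
  · rintro _ ⟨r, hr, i, rfl⟩
    refine ⟨Finsupp.single i r, fun j => ?_, hS.laurentSum_single i r⟩
    rw [Finsupp.single_apply]
    split_ifs
    exacts [hr, I.zero_mem]
  · rintro _ _ - - ⟨p, hp, rfl⟩ ⟨p', hp', rfl⟩
    exact ⟨p + p', fun i => I.add_mem (hp i) (hp' i), map_add _ _ _⟩
  · rintro _ - ⟨p, hp, rfl⟩
    exact ⟨-p, fun i => I.neg_mem (hp i), map_neg _ _⟩

theorem laurentSum_surjective (hS : IsCauchonExtension ι x τ δ q ρR ρS) :
    Function.Surjective hS.laurentSum := fun l => by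
  obtain ⟨p, -, hp⟩ := hS.exists_eq_laurentSum (I := ⊤) (hS.mem_laurent_univ l)
  exact ⟨p, hp⟩

/-- Stable ideals of `L` are homogeneous. -/
theorem C_mem_of_laurentSum_mem (hS : IsCauchonExtension ι x τ δ q ρR ρS) {E : TwoSidedIdeal hS.L}
    (hE : ∀ h, ∀ l ∈ E, hS.actionL h l ∈ E) {p : ℤ →₀ R} (hp : hS.laurentSum p ∈ E) (i : ℤ) :
    hS.C (p i) ∈ E := by
  classical
  obtain ⟨h, c, hh, hc, hc'⟩ := hS.exists_twist
  have heig : ∀ i, hS.twist h (hS.C (p i) * hS.xz i) =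
      ((c ^ i : kˣ) : k) • (hS.C (p i) * hS.xz i) := fun i => by
    rw [twist_mul, hS.twist_C hh, hS.twist_xz hc, mul_smul_comm]
  by_cases hi : i ∈ p.support
  · have h1 : hS.C (p i) * hS.xz i ∈ E := by
      refine hS.mem_of_add_sum_mem (hS.twist_mem hE h) (p.support.erase i)
        (fun j => ((c ^ j : kˣ) : k)) _ (fun j => hS.C (p j) * hS.xz j) _ (heig i)
        (fun j _ => heig j) (fun j hj h => (Finset.ne_of_mem_erase hj) (hc'.zpow_injective h)) ?_
      rwa [Finset.add_sum_erase _ (fun j => hS.C (p j) * hS.xz j) hi, ← laurentSum_apply]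
    have h2 := E.mul_mem_right _ (hS.xz (-i)) h1
    rwa [mul_assoc, xz_mul_xz_neg, mul_one] at h2
  · rw [Finsupp.notMem_support_iff.1 hi, C_zero]
    exact E.zero_mem

/-- Uniqueness of Laurent coefficients is homogeneity of the zero ideal together with injectivity of
`C`. -/
theorem eq_zero_of_laurentSum_eq_zero (hS : IsCauchonExtension ι x τ δ q ρR ρS) {p : ℤ →₀ R}
    (hp : hS.laurentSum p = 0) : p = 0 := by
  ext i
  have h1 : hS.C (p i) ∈ (⊥ : TwoSidedIdeal hS.L) := hS.C_mem_of_laurentSum_mem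
    (fun h l hl => by
      rw [TwoSidedIdeal.mem_bot] at hl ⊢
      rw [hl, map_zero])
    ((TwoSidedIdeal.mem_bot _).2 hp) i
  exact hS.eq_zero_of_C_eq_zero ((TwoSidedIdeal.mem_bot _).1 h1)

theorem tau_zpow_mem (hS : IsCauchonExtension ι x τ δ q ρR ρS) {I : TwoSidedIdeal R}
    (hI : IsHStable ρR I) (i : ℤ) {r : R} : (τ ^ i) r ∈ I ↔ r ∈ I := by
  obtain ⟨h, hh, -⟩ := hS.exists_h₀
  have h1 : τ = ρR h := AlgEquiv.ext fun r => (hh r).symm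
  rw [h1, ← map_zpow, hI.mem_iff]

/-- The ideal `⟨C(P)⟩` of `L`. -/
noncomputable abbrev extIdeal (hS : IsCauchonExtension ι x τ δ q ρR ρS) (P : TwoSidedIdeal R) :
    TwoSidedIdeal hS.L := TwoSidedIdeal.span (hS.C '' {r | r ∈ P})

/-! ### The extended ideals ⟨C(P)⟩ -/

section ExtIdeal

variable {P : TwoSidedIdeal R}

theorem C_mem_extIdeal (hS : IsCauchonExtension ι x τ δ q ρR ρS) {r : R} (hr : r ∈ P) :
    hS.C r ∈ hS.extIdeal P := TwoSidedIdeal.subset_span ⟨r, hr, rfl⟩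

theorem laurent_le_of_C_mem (hS : IsCauchonExtension ι x τ δ q ρR ρS) {E : TwoSidedIdeal hS.L}
    (h : ∀ r ∈ P, hS.C r ∈ E) {l : hS.L} (hl : l ∈ hS.laurent {r | r ∈ P}) : l ∈ E :=
  hS.map_mem_of_mem_laurent (AddMonoidHom.id _) (AddSubgroup.ofClass E)
    (fun r hr _ => E.mul_mem_right _ _ (h r hr)) hl

/-- As `P` is stable under all powers of τ, the span of the C(r) xⁱ with r in `P` is already a
two-sided ideal. -/
theorem mem_extIdeal_iff_mem_laurent (hS : IsCauchonExtension ι x τ δ q ρR ρS)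
    (hP : IsHStable ρR P) {l : hS.L} : l ∈ hS.extIdeal P ↔ l ∈ hS.laurent {r | r ∈ P} := by
  refine ⟨fun hl => ?_, hS.laurent_le_of_C_mem fun r => hS.C_mem_extIdeal⟩
  let E : TwoSidedIdeal hS.L := .mk' (hS.laurent {r | r ∈ P}) (zero_mem _) (fun h h' => add_mem h h')
    (fun h => neg_mem h)
    (fun {a b} hb => by
      refine hS.map_mem_of_mem_laurent (AddMonoidHom.mulLeft a) _ (fun r hr i => ?_) hb
      refine hS.map_mem_of_mem_laurent (AddMonoidHom.mulRight (hS.C r * hS.xz i)) _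
        (fun s _ j => ?_) (hS.mem_laurent_univ a)
      change (hS.C s * hS.xz j) * (hS.C r * hS.xz i) ∈ hS.laurent {r | r ∈ P}
      rw [C_mul_xz_mul]
      exact hS.C_mul_xz_mem_laurent (P.mul_mem_left _ _ ((hS.tau_zpow_mem hP j).2 hr)) _)
    (fun {a b} ha => by
      refine hS.map_mem_of_mem_laurent (AddMonoidHom.mulRight b) _ (fun r hr i => ?_) ha
      refine hS.map_mem_of_mem_laurent (AddMonoidHom.mulLeft (hS.C r * hS.xz i)) _
        (fun s _ j => ?_) (hS.mem_laurent_univ b)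
      change (hS.C r * hS.xz i) * (hS.C s * hS.xz j) ∈ hS.laurent {r | r ∈ P}
      rw [C_mul_xz_mul]
      exact hS.C_mul_xz_mem_laurent (P.mul_mem_right _ _ hr) _)
  have hE : hS.extIdeal P ≤ E := TwoSidedIdeal.span_le.2 <| by
    rintro _ ⟨r, hr, rfl⟩
    have := hS.C_mul_xz_mem_laurent (I := {r | r ∈ P}) hr 0
    rw [xz_zero, mul_one] at this
    simpa [E] using this
  simpa [E] using hE hl

theorem actionL_mem_extIdeal (hS : IsCauchonExtension ι x τ δ q ρR ρS) (hP : IsHStable ρR P) (h : H) :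
    ∀ l ∈ hS.extIdeal P, hS.actionL h l ∈ hS.extIdeal P := fun l hl => by
  obtain ⟨c, hc⟩ := hS.exists_unit_eigenvalue h
  refine hS.map_mem_of_mem_laurent (hS.actionL h).toAddMonoidHom
    (AddSubgroup.ofClass (hS.extIdeal P)) (fun r hr i => ?_)
    ((hS.mem_extIdeal_iff_mem_laurent hP).1 hl)
  change hS.actionL h (hS.C r * hS.xz i) ∈ hS.extIdeal P
  rw [map_mul, actionL_C]
  exact (hS.extIdeal P).mul_mem_right _ _ (hS.C_mem_extIdeal (hP h r hr))

theorem exists_eq_laurentSum_of_mem_extIdeal (hS : IsCauchonExtension ι x τ δ q ρR ρS)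
    (hP : IsHStable ρR P) {l : hS.L} (hl : l ∈ hS.extIdeal P) :
    ∃ p : ℤ →₀ R, (∀ i, p i ∈ P) ∧ hS.laurentSum p = l :=
  hS.exists_eq_laurentSum (I := AddSubgroup.ofClass P) ((hS.mem_extIdeal_iff_mem_laurent hP).1 hl)

theorem laurentSum_mem_of_forall (hS : IsCauchonExtension ι x τ δ q ρR ρS) {p : ℤ →₀ R}
    (hp : ∀ i, p i ∈ P) : hS.laurentSum p ∈ hS.extIdeal P := by
  rw [laurentSum_apply]
  exact sum_mem fun i _ => (hS.extIdeal P).mul_mem_right _ _ (hS.C_mem_extIdeal (hp i))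

theorem laurentSum_mem_extIdeal (hS : IsCauchonExtension ι x τ δ q ρR ρS) (hP : IsHStable ρR P)
    {p : ℤ →₀ R} : hS.laurentSum p ∈ hS.extIdeal P ↔ ∀ i, p i ∈ P := by
  refine ⟨fun h i => ?_, hS.laurentSum_mem_of_forall⟩
  obtain ⟨p', hp', h'⟩ := hS.exists_eq_laurentSum_of_mem_extIdeal hP h
  have : p' - p = 0 := hS.eq_zero_of_laurentSum_eq_zero (by rw [map_sub, h', sub_self])
  rw [← sub_eq_zero.1 this]
  exact hp' i

theorem C_mem_extIdeal_iff (hS : IsCauchonExtension ι x τ δ q ρR ρS) (hP : IsHStable ρR P) {r : R} :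
    hS.C r ∈ hS.extIdeal P ↔ r ∈ P := by
  refine ⟨fun h => ?_, hS.C_mem_extIdeal⟩
  have h1 : hS.laurentSum (Finsupp.single 0 r) = hS.C r := by
    rw [laurentSum_single, xz_zero, mul_one]
  rw [← h1, hS.laurentSum_mem_extIdeal hP] at h
  simpa using h 0

theorem laurentSum_mul (hS : IsCauchonExtension ι x τ δ q ρR ρS) (p p' : ℤ →₀ R) :
    hS.laurentSum p * hS.laurentSum p' = hS.laurentSum (∑ ij ∈ p.support ×ˢ p'.support,
      Finsupp.single (ij.1 + ij.2) (p ij.1 * (τ ^ ij.1) (p' ij.2))) := by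
  rw [laurentSum_apply, laurentSum_apply, Finset.sum_mul_sum, map_sum, Finset.sum_product]
  simp only [C_mul_xz_mul, laurentSum_single]

theorem exists_max_notMem {p : ℤ →₀ R} (hp : ∃ i, p i ∉ P) :
    ∃ m, p m ∉ P ∧ ∀ i, m < i → p i ∈ P := by
  classical
  obtain ⟨i, hi⟩ := hp
  have hsupp : ∀ i, p i ∉ P → i ∈ p.support := fun i hi => Finsupp.mem_support_iff.2 fun h0 =>
    hi (h0 ▸ P.zero_mem)
  obtain ⟨m, hm, hmax⟩ := (p.support.filter fun i => p i ∉ P).exists_max_image id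
    ⟨i, Finset.mem_filter.2 ⟨hsupp i hi, hi⟩⟩
  refine ⟨m, (Finset.mem_filter.1 hm).2, fun j hj => ?_⟩
  by_contra hc
  exact hj.not_ge (hmax j (Finset.mem_filter.2 ⟨hsupp j hc, hc⟩))

/-- Take the highest degrees m and n at which the coefficients of the two factors lie outside `P`.
Modulo `P`, the coefficient of the product in degree m + n is p_m τ^m(p'_n), because any other pair
of degrees with that sum exceeds m or n. -/
theorem isCompletelyPrime_extIdeal (hS : IsCauchonExtension ι x τ δ q ρR ρS) (hP : IsHStable ρR P)
    (hp : IsCompletelyPrime P) : IsCompletelyPrime (hS.extIdeal P) := by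
  classical
  refine ⟨fun h => hp.1 (TwoSidedIdeal.eq_top_of_one_mem ?_), fun a b hab => ?_⟩
  · rw [← hS.C_mem_extIdeal_iff hP, h]
    trivial
  obtain ⟨p, rfl⟩ := hS.laurentSum_surjective a
  obtain ⟨p', rfl⟩ := hS.laurentSum_surjective b
  rw [laurentSum_mul, hS.laurentSum_mem_extIdeal hP] at hab
  rw [hS.laurentSum_mem_extIdeal hP, hS.laurentSum_mem_extIdeal hP]
  by_contra! hc
  obtain ⟨m, hm, hm'⟩ := exists_max_notMem hc.1
  obtain ⟨n, hn, hn'⟩ := exists_max_notMem hc.2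
  have hmn : (m, n) ∈ p.support ×ˢ p'.support := Finset.mem_product.2
    ⟨Finsupp.mem_support_iff.2 fun h0 => hm (h0 ▸ P.zero_mem),
      Finsupp.mem_support_iff.2 fun h0 => hn (h0 ▸ P.zero_mem)⟩
  have h1 := hab (m + n)
  rw [Finsupp.finsetSum_apply, ← Finset.add_sum_erase _ _ hmn, Finsupp.single_eq_same] at h1
  have h2 : ∑ ij ∈ (p.support ×ˢ p'.support).erase (m, n),
      Finsupp.single (ij.1 + ij.2) (p ij.1 * (τ ^ ij.1) (p' ij.2)) (m + n) ∈ P := by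
    refine sum_mem fun ij hij => ?_
    rw [Finsupp.single_apply]
    split_ifs with h
    · rcases lt_trichotomy m ij.1 with h3 | h3 | h3
      · exact P.mul_mem_right _ _ (hm' _ h3)
      · exact absurd (Prod.ext h3.symm (by dsimp only; lia)) (Finset.ne_of_mem_erase hij)
      · exact P.mul_mem_left _ _ ((hS.tau_zpow_mem hP _).2 (hn' _ (by lia)))
    · exact P.zero_mem
  have h3 := P.sub_mem h1 h2
  rw [add_sub_cancel_right] at h3
  exact (hp.2 _ _ h3).elim hm fun h => hn ((hS.tau_zpow_mem hP m).1 h)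

end ExtIdeal

end IsCauchonExtension

/-! ### The correspondence between R, L and S -/

namespace IsCauchonExtension

variable {k R S H : Type*} [Field k] [Ring R] [Algebra k R] [Ring S] [Algebra k S] [CommGroup H]
  {ι : R →ₐ[k] S} {x : S} {τ : R ≃ₐ[k] R} {δ : R →ₗ[k] R} {q : kˣ}
  {ρR : H →* (R ≃ₐ[k] R)} {ρS : H →* (S ≃ₐ[k] S)}

section

attribute [local irreducible] IsCauchonExtension.instRingL

section Contraction

variable {P P' : TwoSidedIdeal R}

theorem isHStable_comap_toL (hS : IsCauchonExtension ι x τ δ q ρR ρS) {E : TwoSidedIdeal hS.L}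
    (hE : ∀ h, ∀ l ∈ E, hS.actionL h l ∈ E) : IsHStable ρS (E.comap hS.toL) := fun h s hs => by
  rw [TwoSidedIdeal.mem_comap] at hs ⊢
  rw [← actionL_toL]
  exact hE h _ hs

/-- Each element of L is x^(-n) s with s in S, so an ideal of L is generated by its contraction. -/
theorem le_of_comap_toL_le (hS : IsCauchonExtension ι x τ δ q ρR ρS) {E E' : TwoSidedIdeal hS.L}
    (h : E.comap hS.toL ≤ E'.comap hS.toL) : E ≤ E' := fun l hl => by
  obtain ⟨n, s, rfl⟩ := hS.exists_eq_xz_mul_toL l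
  refine E'.mul_mem_left _ _ ((TwoSidedIdeal.mem_comap _).1 (h ((TwoSidedIdeal.mem_comap _).2 ?_)))
  have := E.mul_mem_left (hS.xz n) _ hl
  rwa [← mul_assoc, xz_mul_xz_neg, one_mul] at this

theorem isHPrime_comap_extIdeal (hS : IsCauchonExtension ι x τ δ q ρR ρS) (hP : IsHPrime ρR P) :
    IsHPrime ρS ((hS.extIdeal P).comap hS.toL) := by
  have hcp := hS.isCompletelyPrime_extIdeal hP.stable (hS.completelyPrime P hP)
  refine IsCompletelyPrime.isHPrime ⟨fun h => hcp.1 (TwoSidedIdeal.eq_top_of_one_mem ?_),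
    fun a b hab => ?_⟩ (hS.isHStable_comap_toL (hS.actionL_mem_extIdeal hP.stable))
  · have h1 : (1 : S) ∈ (hS.extIdeal P).comap hS.toL := h ▸ trivial
    rwa [TwoSidedIdeal.mem_comap, map_one] at h1
  · simp only [TwoSidedIdeal.mem_comap, map_mul] at hab ⊢
    exact hcp.2 _ _ hab

theorem x_notMem_comap_extIdeal (hS : IsCauchonExtension ι x τ δ q ρR ρS) (hP : IsHPrime ρR P) :
    x ∉ (hS.extIdeal P).comap hS.toL := fun hx => by
  rw [TwoSidedIdeal.mem_comap, ← xz_one] at hx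
  have h1 := (hS.extIdeal P).mul_mem_left (hS.xz (-1)) _ hx
  rw [xz_neg_mul_xz, ← C_one, hS.C_mem_extIdeal_iff hP.stable] at h1
  exact hP.one_notMem h1

theorem comap_extIdeal_le_iff (hS : IsCauchonExtension ι x τ δ q ρR ρS) (hP' : IsHStable ρR P') :
    (hS.extIdeal P).comap hS.toL ≤ (hS.extIdeal P').comap hS.toL ↔ P ≤ P' := by
  refine ⟨fun h r hr => ?_, fun h => TwoSidedIdeal.comap_le_comap _
    (TwoSidedIdeal.span_mono (Set.image_mono h))⟩
  exact (hS.C_mem_extIdeal_iff hP').1 (hS.le_of_comap_toL_le h (hS.C_mem_extIdeal hr))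

end Contraction

section Extension

variable {Q : TwoSidedIdeal S}

theorem exists_toL_mul_xz_neg (hS : IsCauchonExtension ι x τ δ q ρR ρS) (s : S) (n : ℕ) :
    ∃ (m : ℕ) (t : S), x ^ m * s = t * x ^ n ∧
      hS.toL s * hS.xz (-n) = hS.xz (-m) * hS.toL t := by
  obtain ⟨m, t, h⟩ := hS.isOreExtension.ore_aux hS.locNilpotent s n
  refine ⟨m, t, h, ?_⟩
  have h1 := congrArg hS.toL h
  rw [map_mul, map_mul, map_pow, map_pow, ← xz_natCast, ← xz_natCast] at h1
  calc hS.toL s * hS.xz (-n) = hS.xz (-m) * (hS.xz m * hS.toL s) * hS.xz (-n) := by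
        rw [← mul_assoc, xz_neg_mul_xz, one_mul]
    _ = _ := by rw [h1, mul_assoc, mul_assoc, xz_mul_xz_neg, mul_one]

/-- An `H`-prime ideal of `S` without `x` is the contraction of an `H`-stable ideal of `L`. -/
theorem exists_comap_toL_eq (hS : IsCauchonExtension ι x τ δ q ρR ρS) (hQ : IsHPrime ρS Q)
    (hx : x ∉ Q) : ∃ E : TwoSidedIdeal hS.L, (∀ h, ∀ l ∈ E, hS.actionL h l ∈ E) ∧
      E.comap hS.toL = Q := by
  let E : TwoSidedIdeal hS.L := .mk' {l | ∃ (n : ℕ) (s : S), s ∈ Q ∧ l = hS.xz (-n) * hS.toL s}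
    ⟨0, 0, Q.zero_mem, by simp⟩
    (by
      rintro _ _ ⟨n, s, hs, rfl⟩ ⟨m, t, ht, rfl⟩
      refine ⟨n + m, x ^ m * s + x ^ n * t,
        Q.add_mem (Q.mul_mem_left _ _ hs) (Q.mul_mem_left _ _ ht), ?_⟩
      rw [map_add, map_mul, map_mul, map_pow, map_pow, ← xz_natCast, ← xz_natCast, mul_add,
        ← mul_assoc, ← mul_assoc, ← xz_add, ← xz_add]
      congr 3 <;> push_cast <;> ring)
    (by
      rintro _ ⟨n, s, hs, rfl⟩
      exact ⟨n, -s, Q.neg_mem hs, by rw [map_neg, mul_neg]⟩)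
    (by
      rintro l _ ⟨n, s, hs, rfl⟩
      obtain ⟨a, u, rfl⟩ := hS.exists_eq_xz_mul_toL l
      obtain ⟨m, t, -, h⟩ := hS.exists_toL_mul_xz_neg u n
      refine ⟨a + m, t * s, Q.mul_mem_left _ _ hs, ?_⟩
      rw [mul_assoc, ← mul_assoc (hS.toL u), h, mul_assoc, ← map_mul, ← mul_assoc, ← xz_add]
      congr 2
      push_cast
      ring)
    (by
      rintro _ l ⟨n, s, hs, rfl⟩
      obtain ⟨a, u, rfl⟩ := hS.exists_eq_xz_mul_toL l
      obtain ⟨m, t, h', h⟩ := hS.exists_toL_mul_xz_neg s a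
      -- Moving x^(-a) to the left of s gives t xᵃ ∈ Q; regularity of x on the right modulo `Q`
      -- cancels the power.
      have ht : t ∈ Q := hS.mem_of_mul_x_pow_mem hQ hx (h' ▸ Q.mul_mem_left _ _ hs)
      refine ⟨n + m, t * u, Q.mul_mem_right _ _ ht, ?_⟩
      rw [mul_assoc, ← mul_assoc (hS.toL s), h, mul_assoc, ← map_mul, ← mul_assoc, ← xz_add]
      congr 2
      push_cast
      ring)
  have hmem : ∀ l, l ∈ E ↔ ∃ (n : ℕ) (s : S), s ∈ Q ∧ l = hS.xz (-n) * hS.toL s := fun l => by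
    simp only [E, TwoSidedIdeal.mem_mk', Set.mem_ofPred_eq]
  refine ⟨E, fun h l hl => ?_, ?_⟩
  · obtain ⟨n, s, hs, rfl⟩ := (hmem l).1 hl
    obtain ⟨c, hc⟩ := hS.exists_unit_eigenvalue h
    rw [map_mul, hS.actionL_xz hc, actionL_toL, smul_mul_assoc]
    exact E.algebra_smul_mem _ ((hmem _).2 ⟨n, _, hQ.stable h s hs, rfl⟩)
  · ext s
    rw [TwoSidedIdeal.mem_comap, hmem]
    refine ⟨fun ⟨n, t, ht, h⟩ => ?_, fun hs => ⟨0, s, hs, by simp [xz_zero]⟩⟩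
    have h1 : hS.toL (x ^ n * s) = hS.toL t := by
      rw [map_mul, h, map_pow, ← xz_natCast, ← mul_assoc, xz_mul_xz_neg, one_mul]
    exact hS.mem_of_x_pow_mul_mem hQ hx (hS.toL_injective h1 ▸ ht)

/-- The deleting-derivation map as a ring homomorphism. -/
noncomputable def CRingHom (hS : IsCauchonExtension ι x τ δ q ρR ρS) : R →+* hS.L where
  toFun := hS.C
  map_one' := hS.C_one
  map_mul' := hS.C_mul
  map_zero' := hS.C_zero
  map_add' := hS.C_add

/-- Let E be the H-stable ideal of L contracting to Q, and P = C⁻¹(E). Homogeneity gives E = ⟨C(P)⟩.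
H-primeness of P follows from that of Q by extending ideals of R to L and contracting to S. -/
theorem exists_comap_extIdeal_eq (hS : IsCauchonExtension ι x τ δ q ρR ρS) (hQ : IsHPrime ρS Q)
    (hx : x ∉ Q) : ∃ P : TwoSidedIdeal R, IsHPrime ρR P ∧ (hS.extIdeal P).comap hS.toL = Q := by
  obtain ⟨E, hE, rfl⟩ := hS.exists_comap_toL_eq hQ hx
  let P : TwoSidedIdeal R := E.comap hS.CRingHom
  have hmem : ∀ r, r ∈ P ↔ hS.C r ∈ E := fun r => TwoSidedIdeal.mem_comap _
  have hP : IsHStable ρR P := fun h r hr => by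
    rw [hmem] at hr ⊢
    rw [← actionL_C]
    exact hE h _ hr
  have hEP : hS.extIdeal P = E := by
    refine le_antisymm (TwoSidedIdeal.span_le.2 ?_) fun l hl => ?_
    · rintro _ ⟨r, hr, rfl⟩
      exact (hmem r).1 hr
    · obtain ⟨p, rfl⟩ := hS.laurentSum_surjective l
      exact hS.laurentSum_mem_of_forall fun i => (hmem _).2 (hS.C_mem_of_laurentSum_mem hE hl i)
  refine ⟨P, ⟨fun h => ?_, hP, fun I J hI hJ hIJ => ?_⟩, by rw [hEP]⟩
  · have h1 : (1 : R) ∈ P := h ▸ trivial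
    rw [hmem, C_one] at h1
    exact hQ.one_notMem ((TwoSidedIdeal.mem_comap _).2 (by rwa [map_one]))
  · rw [← hS.comap_extIdeal_le_iff hP, ← hS.comap_extIdeal_le_iff hP, hEP]
    refine hQ.prime _ _ (hS.isHStable_comap_toL (hS.actionL_mem_extIdeal hI))
      (hS.isHStable_comap_toL (hS.actionL_mem_extIdeal hJ)) fun a ha b hb => ?_
    rw [TwoSidedIdeal.mem_comap, hS.mem_extIdeal_iff_mem_laurent hI] at ha
    rw [TwoSidedIdeal.mem_comap, hS.mem_extIdeal_iff_mem_laurent hJ] at hb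
    rw [TwoSidedIdeal.mem_comap, map_mul]
    refine hS.map_mem_of_mem_laurent (AddMonoidHom.mulRight (hS.toL b)) (AddSubgroup.ofClass E)
      (fun r hr i => ?_) ha
    refine hS.map_mem_of_mem_laurent (AddMonoidHom.mulLeft (hS.C r * hS.xz i))
      (AddSubgroup.ofClass E) (fun s hs j => ?_) hb
    change (hS.C r * hS.xz i) * (hS.C s * hS.xz j) ∈ E
    rw [C_mul_xz_mul]
    exact E.mul_mem_right _ _ ((hmem _).1 (hIJ _ hr _ ((hS.tau_zpow_mem hJ i).2 hs)))

end Extension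

end

/-- The order embedding `P ↦ ⟨C(P)⟩ ∩ S`. -/
noncomputable def deletingEmbedding (hS : IsCauchonExtension ι x τ δ q ρR ρS) :
    HSpec ρR ↪o {Q : HSpec ρS // x ∉ Q.1} :=
  OrderEmbedding.ofMapLEIff
    (fun P => ⟨⟨(hS.extIdeal P.1).comap hS.toL, hS.isHPrime_comap_extIdeal P.2⟩,
      hS.x_notMem_comap_extIdeal P.2⟩)
    fun _ P' => hS.comap_extIdeal_le_iff P'.2.stable

theorem deletingEmbedding_surjective (hS : IsCauchonExtension ι x τ δ q ρR ρS) :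
    Function.Surjective hS.deletingEmbedding := fun Q => by
  obtain ⟨P, hP, h⟩ := hS.exists_comap_extIdeal_eq Q.1.2 Q.2
  exact ⟨⟨P, hP⟩, Subtype.ext (Subtype.ext h)⟩

end IsCauchonExtension

theorem mainTheorem10 {k R S H : Type*} [Field k] [Ring R] [Algebra k R] [Ring S] [Algebra k S]
    [CommGroup H] (ι : R →ₐ[k] S) (x : S) (τ : R ≃ₐ[k] R) (δ : R →ₗ[k] R) (q : kˣ)
    (ρR : H →* (R ≃ₐ[k] R)) (ρS : H →* (S ≃ₐ[k] S))
    (hS : IsCauchonExtension ι x τ δ q ρR ρS) :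
    ∃ Ctilde : HSpec ρR ≃o {Q : HSpec ρS // x ∉ Q.1},
      ∀ P : HSpec ρR, (Ctilde P).1.1 =
        (TwoSidedIdeal.span (hS.C '' {r : R | r ∈ P.1})).comap hS.toL :=
  ⟨RelIso.ofSurjective hS.deletingEmbedding hS.deletingEmbedding_surjective, fun _ => rfl⟩
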